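/- Let $d\ge 1$, let $\mathcal L$ denote Lebesgue measure on $\mathbb R^d$, let $\lambda>\mu>0$, and let $S\subset\mathbb R^d$ be a Borel set with $\mathcal L(S)\in(0,\infty)$. A simple point measure on $S$ is a measure of the form $\nu=\sum_{a\in A}\delta_a$, where $A\subset S$ has finitely many points in every bounded region of $\mathbb R^d$; the points of $\nu$ are the elements of $A$, and the space $\mathbb M_S$ of simple point measures on $S$ carries the $\sigma$-algebra generated by the maps $\nu\mapsto\nu(B)$, $B\subset S$ Borel. A homogeneous Poisson process of intensity $c>0$ on $S$ is a random element $\Pi$ of $\mathbb M_S$ such that $\Pi(B)$ is Poisson with mean $c\,\mathcal L(B)$ for every Borel $B\subset S$, and $\Pi(B_1),\dots,\Pi(B_n)$ are independent whenever $B_1,\dots,B_n\subset S$ are pairwise disjoint Borel sets. Let $\Pi$ be a homogeneous Poisson process of intensity $\lambda$ on $S$, and let $X$ and $Y$ be Poisson random variables with means $\lambda\,\mathcal L(S)$ and $\mu\,\mathcal L(S)$ respectively. The following are equivalent. (i) There is a measurable function $f:\mathbb M_S\to\mathbb M_S$ such that $f(\Pi)$ is a homogeneous Poisson process of intensity $\mu$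 on $S$, and almost surely every point of $f(\Pi)$ is a point of $\Pi$. (ii) There is an integer $k\ge 0$ such that $\mathbb P(X=k)\le\mathbb P(Y=k)$ and $\mathbb P(X\le k+1)\le\mathbb P(Y\le k)$. (iii) There is no integer $k\ge 0$ such that $\mathbb P(X=k+1)>\mathbb P(Y=k+1)$ and $\mathbb P(X\le k+1)>\mathbb P(Y\le k)$. -/

import Mathlib

open MeasureTheory ProbabilityTheory
open scoped NNReal ENNReal

noncomputable section

/-- A simple point measure on `S ⊆ ℝ^d`: a sum of unit point masses at the points of a set `A ⊆ S`
which is locally finite, i.e. has only finitely many points in each bounded region of `ℝ^d`. -/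
def IsSimplePointMeasure {d : ℕ} {S : Set (EuclideanSpace ℝ (Fin d))} (ν : Measure S) : Prop :=
  ∃ A : Set S, (∀ r : ℝ, {x ∈ A | ‖(x : EuclideanSpace ℝ (Fin d))‖ ≤ r}.Finite) ∧
    ν = Measure.sum (fun a : A => Measure.dirac (a : S))

/-- The space of simple point measures on `S`. It carries the `σ`-algebra generated by the
evaluations `ν ↦ ν B`, `B ⊆ S` Borel (the subtype `σ`-algebra from Mathlib's one on `Measure S`). -/
abbrev SimplePointMeasure {d : ℕ} (S : Set (EuclideanSpace ℝ (Fin d))) : Type :=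
  {ν : Measure S // IsSimplePointMeasure ν}

/-- The set `[ν]` of points of a simple point measure. -/
def SimplePointMeasure.points {d : ℕ} {S : Set (EuclideanSpace ℝ (Fin d))}
    (ν : SimplePointMeasure S) : Set S :=
  {x | ν.1 {x} = 1}

/-- `N` is a homogeneous Poisson point process of intensity `c` on the set `S` (of finite volume):
a random simple point measure on `S` whose number of points in a Borel set `B ⊆ S` is Poisson
with mean `c` times the volume of `B`, and whose numbers of points in finitely many pairwise
disjoint Borel subsets of `S` are independent. -/
structure IsPoissonProcess {Ω : Type*} [MeasurableSpace Ω] {d : ℕ}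
    {S : Set (EuclideanSpace ℝ (Fin d))} (N : Ω → SimplePointMeasure S) (c : ℝ≥0)
    (P : Measure Ω) : Prop where
  measurable : Measurable N
  hasLaw_count : ∀ B : Set S, MeasurableSet B →
    HasLaw (fun ω => (N ω).1 B)
      ((poissonMeasure (c * (volume (Subtype.val '' B)).toNNReal)).map (Nat.cast : ℕ → ℝ≥0∞)) P
  indep_count : ∀ (n : ℕ) (B : Fin n → Set S), (∀ i, MeasurableSet (B i)) →
    Pairwise (fun i j => Disjoint (B i) (B j)) →
    iIndepFun (fun i ω => (N ω).1 (B i)) P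

/-- `f` is a deterministic Poisson thinning of the process `N` to intensity `c`. -/
structure IsThinning {Ω : Type*} [MeasurableSpace Ω] {d : ℕ}
    {S : Set (EuclideanSpace ℝ (Fin d))} (f : SimplePointMeasure S → SimplePointMeasure S)
    (N : Ω → SimplePointMeasure S) (c : ℝ≥0) (P : Measure Ω) : Prop where
  measurable : Measurable f
  isPoissonProcess : IsPoissonProcess (fun ω => f (N ω)) c P
  points_subset : ∀ᵐ ω ∂P, (f (N ω)).points ⊆ (N ω).points

end

/-! Given its number of points, a Poisson process on `S` is an i.i.d. uniform sample, whatever its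
intensity (`isPoissonProcess_iff_map_eq`). The question is thus which couplings of X and Y below the
diagonal can be realised without external randomness.

Obstruction (`not_isThinning`): let E be the set of configurations with k + 1 points whose image
under f has k + 1 points. Almost surely Π ∈ E forces f(Π) = Π, hence f(Π) ∈ E. The two probabilities
are P(X = k + 1) s and P(Y = k + 1) s, where s is the chance that k + 1 uniform points lie in E. If
P(X = k + 1) > P(Y = k + 1), then s = 0: some point is always lost from k + 1 points, so X ≤ k + 1
leaves at most k points and P(X ≤ k + 1) ≤ P(Y ≤ k).

Construction (`exists_isThinning`): under (ii) the mass inequality passes to all smaller indices and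
the inequality of distribution functions to all larger ones. Hence X and Y have a coupling that
fixes every n ≤ k and strictly lowers every n > k (`exists_coupling`). The randomness comes from the
discarded points. Each point carries independent uniform labels v and w. The points are ranked by v,
and the sum of all the w modulo 1 selects the set of ranks to keep. A discarded point alone makes
this sum uniform given the other points, so the selection is independent of the positions kept
(`measure_tuple_selected`). This is why n must be either unchanged or strictly lowered.

Finally, (iii) implies (ii) because the two Poisson mass functions cross
(`exists_poissonMass_crossing`), and the crossing index serves as k. -/

/-! ### Couplings of distributions on the natural numbers -/

open Finset Filter Topology in
/-- Two summable nonnegative sequences with the same total mass, such that the first one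
(strictly) dominates the second one stochastically, can be coupled below the diagonal. -/
lemma exists_subdiagonal_coupling {p q : ℕ → ℝ} (hp : ∀ n, 0 ≤ p n) (hq : ∀ n, 0 ≤ q n) {M : ℝ}
    (hpM : HasSum p M) (hqM : HasSum q M)
    (h : ∀ n, p n ≠ 0 → ∑ i ∈ range (n + 1), p i ≤ ∑ i ∈ range n, q i) :
    ∃ J : ℕ → ℕ → ℝ≥0∞, (∀ n, ∑' j, J n j = ENNReal.ofReal (p n)) ∧
      (∀ j, ∑' n, J n j = ENNReal.ofReal (q j)) ∧
      ∀ n j, J n j ≠ 0 → p n ≠ 0 ∧ j < n := by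
  have mono : ∀ {p : ℕ → ℝ}, (∀ n, 0 ≤ p n) → Monotone fun n => ∑ i ∈ range n, p i := by
    intro p hp
    exact monotone_nat_of_le_succ fun n => by rw [sum_range_succ]; linarith [hp n]
  have union : ∀ {p : ℕ → ℝ}, (∀ n, 0 ≤ p n) → HasSum p M →
      ⋃ n, Set.Ico (∑ i ∈ range n, p i) (∑ i ∈ range (n + 1), p i) = Set.Ico 0 M := by
    intro p hp hpM
    ext x
    simp only [Set.mem_iUnion, Set.mem_Ico]
    constructor
    · rintro ⟨n, h1, h2⟩
      exact ⟨(sum_nonneg fun i _ => hp i).trans h1,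
        h2.trans_le (sum_le_hasSum _ (fun i _ => hp i) hpM)⟩
    · rintro ⟨h0, hM⟩
      have ex : ∃ n, x < ∑ i ∈ range n, p i :=
        (hpM.tendsto_sum_nat.eventually (lt_mem_nhds hM)).exists
      classical
      obtain ⟨m, hm⟩ : ∃ m, Nat.find ex = m + 1 := by
        refine Nat.exists_eq_succ_of_ne_zero fun h => ?_
        have := Nat.find_spec ex
        rw [h] at this
        simp at this
        linarith
      refine ⟨m, ?_, hm ▸ Nat.find_spec ex⟩
      exact not_lt.1 (Nat.find_min ex (hm ▸ Nat.lt_succ_self m))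
  -- Quantile coupling: `[0, M)` is tiled by consecutive intervals of lengths `p n` and again by
  -- intervals of lengths `q j`; `J n j` will be the length of the overlap.
  set I : ℕ → Set ℝ := fun n => Set.Ico (∑ i ∈ range n, p i) (∑ i ∈ range (n + 1), p i) with hI
  set K : ℕ → Set ℝ := fun n => Set.Ico (∑ i ∈ range n, q i) (∑ i ∈ range (n + 1), q i) with hK
  have vI : ∀ n, volume (I n) = ENNReal.ofReal (p n) := fun n => by
    simp [hI, Real.volume_Ico, sum_range_succ]
  have vK : ∀ n, volume (K n) = ENNReal.ofReal (q n) := fun n => by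
    simp [hK, Real.volume_Ico, sum_range_succ]
  have dI : Pairwise (Function.onFun Disjoint I) := (mono hp).pairwise_disjoint_on_Ico_succ
  have dK : Pairwise (Function.onFun Disjoint K) := (mono hq).pairwise_disjoint_on_Ico_succ
  refine ⟨fun n j => volume (I n ∩ K j), fun n => ?_, fun j => ?_, fun n j hJ => ?_⟩
  · rw [← measure_iUnion (fun i j hij => (dK hij).mono Set.inter_subset_right
      Set.inter_subset_right) (fun j => measurableSet_Ico.inter measurableSet_Ico),
      ← Set.inter_iUnion, union hq hqM, ← union hp hpM, Set.inter_eq_left.2, vI]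
    exact Set.subset_iUnion I n
  · rw [← measure_iUnion (fun i j hij => (dI hij).mono Set.inter_subset_left
      Set.inter_subset_left) (fun j => measurableSet_Ico.inter measurableSet_Ico),
      ← Set.iUnion_inter, union hp hpM, ← union hq hqM, Set.inter_eq_right.2, vK]
    exact Set.subset_iUnion K j
  · have hpn : p n ≠ 0 := by
      intro h0
      refine hJ (measure_mono_null Set.inter_subset_left ?_)
      rw [vI, h0, ENNReal.ofReal_zero]
    refine ⟨hpn, ?_⟩
    -- If `n ≤ j`, then `K j` starts no earlier than the sum of the first `n` terms of `q`, where by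
    -- `h` the interval `I n` has already ended.
    by_contra hjn
    obtain ⟨x, hx, hx'⟩ := nonempty_of_measure_ne_zero hJ
    have h1 := h n hpn
    have h2 := mono hq (not_lt.1 hjn)
    simp only [hI, hK, Set.mem_Ico] at hx hx' h2
    linarith

open Finset Filter Topology in
/-- A coupling of two distributions on `ℕ` that is diagonal on the rows up to `k` and strictly
below the diagonal on the other rows. -/
lemma exists_coupling {p q : ℕ → ℝ} (hp : ∀ n, 0 ≤ p n) (hq : ∀ n, 0 ≤ q n)
    (hp1 : HasSum p 1) (hq1 : HasSum q 1) (k : ℕ) (hle : ∀ j ≤ k, p j ≤ q j)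
    (h : ∀ m, k ≤ m → ∑ i ∈ range (m + 2), p i ≤ ∑ i ∈ range (m + 1), q i) :
    ∃ J : ℕ → ℕ → ℝ≥0∞, (∀ n, ∑' j, J n j = ENNReal.ofReal (p n)) ∧
      (∀ j, ∑' n, J n j = ENNReal.ofReal (q j)) ∧
      ∀ n j, J n j ≠ 0 → (n ≤ k ∧ j = n) ∨ (k < n ∧ j < n) := by
  -- The diagonal part of the coupling. Removing it from both sides leaves a first marginal carried
  -- by `n > k`, the only rows on which domination is then required.
  set e : ℕ → ℝ := fun n => if n ≤ k then p n else 0 with he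
  have e0 : ∀ n, 0 ≤ e n := fun n => by simp only [he]; split_ifs <;> simp [hp]
  have esum : HasSum e (∑ i ∈ range (k + 1), e i) :=
    hasSum_sum_of_ne_finset_zero fun n hn => by
      simp only [mem_range, not_lt] at hn
      simp only [he]
      rw [if_neg (by omega)]
  have ele : ∀ n, e n ≤ p n := fun n => by simp only [he]; split_ifs <;> simp [hp]
  have eleq : ∀ n, e n ≤ q n := fun n => by
    simp only [he]; split_ifs with h
    exacts [hle n h, hq n]
  obtain ⟨J, h1, h2, h3⟩ := exists_subdiagonal_coupling (p := fun n => p n - e n)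
    (q := fun n => q n - e n) (fun n => by linarith [ele n]) (fun n => by linarith [eleq n])
    (hp1.sub esum) (hq1.sub esum) (by
      intro n hn
      have hkn : k < n := by
        by_contra hkn
        exact hn (by simp only [he]; rw [if_pos (by omega)]; ring)
      obtain ⟨m, rfl⟩ : ∃ m, n = m + 1 := ⟨n - 1, by omega⟩
      rw [sum_sub_distrib, sum_sub_distrib, sum_range_succ e (m + 1)]
      have : e (m + 1) = 0 := by simp only [he]; rw [if_neg (by omega)]
      linarith [h m (by omega)])
  refine ⟨fun n j => (if j = n then ENNReal.ofReal (e n) else 0) + J n j, fun n => ?_, fun j => ?_,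
    fun n j hJ => ?_⟩
  · rw [ENNReal.tsum_add, tsum_ite_eq, h1, ← ENNReal.ofReal_add (e0 n) (by linarith [ele n])]
    congr 1; ring
  · have : ∀ n, (if j = n then ENNReal.ofReal (e n) else 0)
        = if n = j then ENNReal.ofReal (e j) else 0 := fun n => by
      by_cases h : j = n
      · subst h; simp
      · rw [if_neg h, if_neg (Ne.symm h)]
    rw [ENNReal.tsum_add, h2]
    simp_rw [this]
    rw [tsum_ite_eq, ← ENNReal.ofReal_add (e0 j) (by linarith [eleq j])]
    congr 1; ring
  · beta_reduce at hJ
    by_cases hJn : J n j = 0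
    · rw [hJn, add_zero] at hJ
      split_ifs at hJ with hj
      · refine Or.inl ⟨?_, hj⟩
        by_contra hn
        simp [he, if_neg hn] at hJ
      · exact absurd rfl hJ
    · refine Or.inr ⟨?_, (h3 n j hJn).2⟩
      by_contra hkn
      exact (h3 n j hJn).1 (by simp only [he]; rw [if_pos (by omega)]; ring)

/-! ### Comparison of two Poisson distributions -/

/-- The mass function of the Poisson distribution. -/
noncomputable def poissonMass (a : ℝ) (n : ℕ) : ℝ := Real.exp (-a) * a ^ n / n.factorial

lemma poissonMass_pos {a : ℝ} (ha : 0 < a) (n : ℕ) : 0 < poissonMass a n := by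
  unfold poissonMass; positivity

lemma hasSum_poissonMass (a : ℝ≥0) : HasSum (poissonMass a) 1 := hasSum_one_poissonMeasure a

/-- The likelihood ratio is geometric in `n`, hence monotone; this gives the single crossing of the
mass functions. -/
lemma poissonMass_le_iff {a b : ℝ} (hb : 0 < b) (n : ℕ) :
    poissonMass a n ≤ poissonMass b n ↔ (a / b) ^ n ≤ Real.exp (a - b) := by
  unfold poissonMass
  rw [div_le_div_iff_of_pos_right (by positivity), div_pow, div_le_iff₀ (by positivity),
    ← mul_le_mul_iff_right₀ (Real.exp_pos a), ← mul_assoc, ← mul_assoc, ← Real.exp_add,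
    ← Real.exp_add]
  simp [sub_eq_add_neg]

lemma poissonMass_le_of_le {a b : ℝ} (hb : 0 < b) (hab : b < a) {m n : ℕ} (hmn : m ≤ n)
    (h : poissonMass a n ≤ poissonMass b n) : poissonMass a m ≤ poissonMass b m := by
  rw [poissonMass_le_iff hb] at h ⊢
  exact (pow_le_pow_right₀ ((one_le_div hb).2 hab.le) hmn).trans h

lemma exists_lt_poissonMass {a b : ℝ} (hb : 0 < b) (hab : b < a) :
    ∃ n, poissonMass b n < poissonMass a n := by
  obtain ⟨n, hn⟩ := pow_unbounded_of_one_lt (Real.exp (a - b)) ((one_lt_div hb).2 hab)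
  refine ⟨n, ?_⟩
  rw [← not_le, poissonMass_le_iff hb, not_le]
  exact hn

/-- The difference P(Y < n) − P(X ≤ n) grows by P(Y = n) − P(X = n + 1) as `n` becomes `n + 1`. Its
sign is read off by comparing `(a / b) ^ n / (n + 1)` with a constant. -/
lemma poissonMass_succ_le_iff {a b : ℝ} (ha : 0 < a) (hb : 0 < b) (n : ℕ) :
    poissonMass a (n + 1) ≤ poissonMass b n ↔
      (a / b) ^ n / (n + 1) ≤ Real.exp (a - b) / a := by
  have h1 : poissonMass a (n + 1)
      = Real.exp (-a) * a * b ^ n / n.factorial * ((a / b) ^ n / (n + 1)) := by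
    unfold poissonMass
    rw [Nat.factorial_succ, div_pow]
    push_cast
    field_simp
    ring
  have h2 : poissonMass b n
      = Real.exp (-a) * a * b ^ n / n.factorial * (Real.exp (a - b) / a) := by
    unfold poissonMass
    rw [show -b = -a + (a - b) by ring, Real.exp_add]
    field_simp
  rw [h1, h2, mul_le_mul_iff_right₀ (by positivity)]

/-- If `n ↦ c ^ n / (n + 1)` with `c > 1` has increased somewhere, it keeps increasing. -/
lemma pow_div_succ_le_of_lt {c : ℝ} (hc : 1 < c) {i j l : ℕ} (hij : i ≤ j) (hjl : j ≤ l)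
    (h : c ^ i / ((i : ℝ) + 1) < c ^ j / ((j : ℝ) + 1)) :
    c ^ j / ((j : ℝ) + 1) ≤ c ^ l / ((l : ℝ) + 1) := by
  set r : ℕ → ℝ := fun n => c ^ n / ((n : ℝ) + 1) with hr
  have c0 : 0 < c := by linarith
  -- The right-hand condition persists when `n` grows, so one increase forces all later ones.
  have step : ∀ n, r n < r (n + 1) ↔ 1 < (c - 1) * (n + 1) := fun n => by
    simp only [hr]
    rw [div_lt_div_iff₀ (by positivity) (by positivity), pow_succ]
    push_cast
    rw [mul_assoc, mul_lt_mul_iff_right₀ (by positivity)]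
    constructor <;> intro h <;> linarith
  obtain ⟨m, hmj, hm⟩ : ∃ m < j, r m < r (m + 1) := by
    by_contra! hno
    have : ∀ n, i ≤ n → n ≤ j → r n ≤ r i := fun n hn => by
      induction n, hn using Nat.le_induction with
      | base => exact fun _ => le_rfl
      | succ n _ ih => exact fun hnj => (hno n (by omega)).trans (ih (by omega))
    exact absurd h (not_lt.2 (this j hij le_rfl))
  rw [step] at hm
  show r j ≤ r l
  induction l, hjl using Nat.le_induction with
  | base => exact le_rfl
  | succ n hn ih =>
    refine ih.trans ((step n).2 (hm.trans_le ?_)).le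
    have : (m : ℝ) ≤ n := by exact_mod_cast (by omega : m ≤ n)
    nlinarith

-- The difference D of the two sides starts negative and tends to 0. If it were nonnegative at `k +
-- 1` and negative later, it would have risen and then fallen; by `pow_div_succ_le_of_lt` it could
-- never rise again, so its limit would be negative.
open Finset Filter Topology in
lemma sum_poissonMass_succ_le {a b : ℝ≥0} (hb : 0 < b) (hab : b < a) {k : ℕ}
    (hk : ∑ i ∈ range (k + 2), poissonMass a i ≤ ∑ i ∈ range (k + 1), poissonMass b i) {m : ℕ}
    (hkm : k ≤ m) :
    ∑ i ∈ range (m + 2), poissonMass a i ≤ ∑ i ∈ range (m + 1), poissonMass b i := by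
  have hb' : (0 : ℝ) < b := hb
  have hab' : (b : ℝ) < a := hab
  have ha' : (0 : ℝ) < a := hb'.trans hab'
  set D : ℕ → ℝ := fun m => ∑ i ∈ range m, poissonMass b i - ∑ i ∈ range (m + 1), poissonMass a i
    with hD
  have step : ∀ n, D (n + 1) = D n + (poissonMass b n - poissonMass a (n + 1)) := fun n => by
    simp only [hD]
    rw [sum_range_succ _ n, sum_range_succ _ (n + 1)]
    ring
  have lim : Tendsto D atTop (𝓝 0) := by
    have h1 := (hasSum_poissonMass b).tendsto_sum_nat
    have h2 := (tendsto_add_atTop_iff_nat 1).2 (hasSum_poissonMass a).tendsto_sum_nat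
    simpa using h1.sub h2
  have hD0 : D 0 < 0 := by simp [hD, poissonMass_pos ha']
  have hDk : 0 ≤ D (k + 1) := by simp only [hD]; linarith
  suffices h : 0 ≤ D (m + 1) by simp only [hD] at h; linarith
  by_contra! hDm
  obtain ⟨i, hik, hi⟩ : ∃ i ≤ k, D i < D (i + 1) := by
    by_contra! hno
    have : ∀ n ≤ k + 1, D n ≤ D 0 := fun n => by
      induction n with
      | zero => exact fun _ => le_rfl
      | succ n ih => exact fun hn => (hno n (by omega)).trans (ih (by omega))
    linarith [this (k + 1) le_rfl]
  obtain ⟨j, hkj, hjm, hj⟩ : ∃ j, k + 1 ≤ j ∧ j ≤ m ∧ D (j + 1) < D j := by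
    by_contra! hno
    have : ∀ n, k + 1 ≤ n → n ≤ m + 1 → D (k + 1) ≤ D n := fun n hn => by
      induction n, hn using Nat.le_induction with
      | base => exact fun _ => le_rfl
      | succ n hn ih => exact fun hnm => (ih (by omega)).trans (hno n hn (by omega))
    linarith [this (m + 1) (by omega) le_rfl]
  have hi' := (poissonMass_succ_le_iff ha' hb' i).1 (by linarith [step i])
  have hj' : ¬ _ := mt (poissonMass_succ_le_iff ha' hb' j).2 (by linarith [step j])
  have dec : ∀ n, m + 1 ≤ n → D n ≤ D (m + 1) := fun n hn => by
    induction n, hn using Nat.le_induction with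
    | base => exact le_rfl
    | succ n hn ih =>
      have := pow_div_succ_le_of_lt ((one_lt_div hb').2 hab') (show i ≤ j by omega)
        (show j ≤ n by omega) (hi'.trans_lt (not_le.1 hj'))
      have hn' := mt (poissonMass_succ_le_iff ha' hb' n).1
        (not_le.2 ((not_le.1 hj').trans_le this))
      linarith [step n, not_le.1 hn']
  linarith [le_of_tendsto lim (eventually_atTop.2 ⟨m + 1, dec⟩)]

/-! ### Uniform labels extracted from atomless laws -/

lemma continuous_cdf (μ : Measure ℝ) [IsProbabilityMeasure μ] [NullSingletonClass μ] :
    Continuous (cdf μ) := by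
  rw [continuous_iff_continuousAt]
  intro x
  rw [(monotone_cdf μ).continuousAt_iff_leftLim_eq_rightLim, (cdf μ).rightLim_eq]
  have h : (cdf μ).measure {x} = 0 := by rw [measure_cdf]; exact measure_singleton x
  rw [StieltjesFunction.measure_singleton, ENNReal.ofReal_eq_zero] at h
  exact le_antisymm ((monotone_cdf μ).leftLim_le le_rfl) (by linarith)

open Set Filter Topology in
/-- Probability integral transform: the distribution function of an atomless distribution
is uniformly distributed. -/
lemma measure_cdf_le (μ : Measure ℝ) [IsProbabilityMeasure μ] [NullSingletonClass μ] {t : ℝ}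
    (h0 : 0 ≤ t) (h1 : t ≤ 1) : μ {x | cdf μ x ≤ t} = ENNReal.ofReal t := by
  have ivt : ∀ s, 0 < s → s < 1 → ∃ x, cdf μ x = s := fun s hs0 hs1 => by
    obtain ⟨x, hx⟩ := ((tendsto_cdf_atBot μ).eventually (gt_mem_nhds hs0)).exists
    obtain ⟨y, hy⟩ := ((tendsto_cdf_atTop μ).eventually (lt_mem_nhds hs1)).exists
    exact mem_range_of_exists_le_of_exists_ge (continuous_cdf μ) ⟨x, hx.le⟩ ⟨y, hy.le⟩
  rcases h1.eq_or_lt with rfl | h1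
  · simp [cdf_le_one]
  apply le_antisymm
  -- A level strictly above `t` is needed: where the distribution function is flat, a point at level
  -- `t` need not bound `{x | cdf μ x ≤ t}`.
  · refine ENNReal.le_of_forall_pos_le_add ?_
    intro ε hε _
    by_cases hs : t + ε < 1
    · obtain ⟨x, hx⟩ := ivt (t + ε) (by positivity) hs
      calc μ {x | cdf μ x ≤ t} ≤ μ (Iic x) := by
            refine measure_mono fun y hy => ?_
            by_contra hyx
            have := monotone_cdf μ (not_le.1 hyx).le
            have hε' : (0 : ℝ) < ε := hε
            simp only [mem_ofPred_eq] at hy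
            linarith
        _ = ENNReal.ofReal t + ε := by
            rw [← ofReal_cdf, hx, ENNReal.ofReal_add h0 ε.coe_nonneg, ENNReal.ofReal_coe_nnreal]
    · calc μ {x | cdf μ x ≤ t} ≤ ENNReal.ofReal 1 := by simpa using prob_le_one
        _ ≤ ENNReal.ofReal (t + ε) := ENNReal.ofReal_le_ofReal (not_lt.1 hs)
        _ = ENNReal.ofReal t + ε := by
            rw [ENNReal.ofReal_add h0 ε.coe_nonneg, ENNReal.ofReal_coe_nnreal]
  · rcases h0.eq_or_lt with rfl | h0
    · simp
    obtain ⟨x, hx⟩ := ivt t h0 h1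
    rw [← hx, ofReal_cdf]
    exact measure_mono fun y hy => monotone_cdf μ hy

open unitInterval in
lemma map_cdf_eq_volume (μ : Measure ℝ) [IsProbabilityMeasure μ] [NullSingletonClass μ] :
    μ.map (fun x => (⟨cdf μ x, cdf_nonneg μ x, cdf_le_one μ x⟩ : I)) = volume := by
  have hm : Measurable (fun x => (⟨cdf μ x, cdf_nonneg μ x, cdf_le_one μ x⟩ : I)) :=
    (continuous_cdf μ).measurable.subtype_mk
  have := Measure.isProbabilityMeasure_map (μ := μ) hm.aemeasurable
  refine Measure.ext_of_Iic _ _ fun t => ?_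
  rw [Measure.map_apply hm measurableSet_Iic, unitInterval.volume_Iic]
  exact measure_cdf_le μ t.2.1 t.2.2

/-- Any probability distribution on a standard Borel space can be realised on an atomless
probability space over the reals. -/
lemma exists_measurable_map_eq_of_real (μ : Measure ℝ) [IsProbabilityMeasure μ]
    [NullSingletonClass μ] {Y : Type*} [MeasurableSpace Y] [StandardBorelSpace Y]
    (τ : Measure Y) [IsProbabilityMeasure τ] : ∃ g : ℝ → Y, Measurable g ∧ μ.map g = τ := by
  have : Nonempty Y := τ.nonempty_of_neZero
  obtain ⟨f, hf, hfτ⟩ := τ.exists_measurable_map_eq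
  have hm : Measurable (fun x => (⟨cdf μ x, cdf_nonneg μ x, cdf_le_one μ x⟩ : unitInterval)) :=
    (continuous_cdf μ).measurable.subtype_mk
  refine ⟨_, hf.comp hm, ?_⟩
  rw [← Measure.map_map hf hm, map_cdf_eq_volume, hfτ]

lemma measurable_coe_unitAddCircle : Measurable ((↑) : ℝ → UnitAddCircle) :=
  (AddCircle.continuous_mk' 1).measurable

/-- Any probability distribution on a standard Borel space is the law of a function on the
circle. -/
lemma exists_measurable_map_eq_of_unitAddCircle {Y : Type*} [MeasurableSpace Y]
    [StandardBorelSpace Y] (τ : Measure Y) [IsProbabilityMeasure τ] :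
    ∃ g : UnitAddCircle → Y, Measurable g ∧ (volume : Measure UnitAddCircle).map g = τ := by
  have he : Measurable (fun z => (AddCircle.equivIoc (1 : ℝ) 0 z : ℝ)) :=
    measurable_subtype_coe.comp (AddCircle.measurableEquivIoc (1 : ℝ) 0).measurable
  have hμ : (volume : Measure UnitAddCircle).map (fun z => (AddCircle.equivIoc (1 : ℝ) 0 z : ℝ))
      = volume.restrict (Set.Ioc 0 (0 + 1)) := by
    rw [← map_comap_subtype_coe measurableSet_Ioc,
      ← (AddCircle.measurePreserving_equivIoc (1 : ℝ) (a := 0)).map_eq,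
      Measure.map_map measurable_subtype_coe
        (AddCircle.measurePreserving_equivIoc (1 : ℝ) (a := 0)).measurable]
    rfl
  have : IsProbabilityMeasure (volume.restrict (Set.Ioc 0 (0 + 1)) : Measure ℝ) := ⟨by simp⟩
  obtain ⟨g, hg, hgτ⟩ := exists_measurable_map_eq_of_real (volume.restrict (Set.Ioc 0 (0 + 1))) τ
  refine ⟨_, hg.comp he, ?_⟩
  rw [← Measure.map_map hg he, hμ, hgτ]

/-- Points of a set of positive dimension carry two independent uniform labels. -/
lemma exists_uniform_labels {d : ℕ} (hd : 1 ≤ d) {S : Set (EuclideanSpace ℝ (Fin d))}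
    (hS : MeasurableSet S) (ρ : Measure S) [IsProbabilityMeasure ρ]
    (hρ : ρ ≪ volume.comap Subtype.val) :
    ∃ v w : S → ℝ, Measurable v ∧ Measurable w ∧ (∀ x, 0 ≤ w x) ∧
      ρ.map (fun x => (v x, w x)) =
        (volume.restrict (Set.Ioc (0 : ℝ) 1)).prod (volume.restrict (Set.Ioc (0 : ℝ) 1)) := by
  let i : Fin d := ⟨0, hd⟩
  have hm : Measurable (fun x : S => (x : EuclideanSpace ℝ (Fin d)) i) := by fun_prop
  have := Measure.isProbabilityMeasure_map (μ := ρ) hm.aemeasurable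
  -- Level sets of one coordinate are hyperplanes, hence null; that single coordinate already
  -- supplies both labels.
  have : NullSingletonClass (ρ.map (fun x : S => (x : EuclideanSpace ℝ (Fin d)) i)) := ⟨fun c => by
    rw [Measure.map_apply hm (measurableSet_singleton c)]
    apply hρ
    have h0 : volume {x : EuclideanSpace ℝ (Fin d) | x i = c} = 0 := by
      have := (PiLp.volume_preserving_ofLp (Fin d)).measure_preimage
        (s := {f | f i = c}) (measurableSet_eq_fun (measurable_pi_apply i)
          measurable_const).nullMeasurableSet
      rw [volume_pi, Measure.pi_hyperplane] at this
      exact this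
    rw [comap_subtype_coe_apply hS]
    refine measure_mono_null ?_ h0
    rintro _ ⟨x, hx, rfl⟩
    exact hx⟩
  have : IsProbabilityMeasure (volume.restrict (Set.Ioc 0 1) : Measure ℝ) := ⟨by simp⟩
  obtain ⟨g, hg, hgτ⟩ := exists_measurable_map_eq_of_real
    (ρ.map (fun x : S => (x : EuclideanSpace ℝ (Fin d)) i))
    ((volume.restrict (Set.Ioc (0 : ℝ) 1)).prod (volume.restrict (Set.Ioc (0 : ℝ) 1)))
  -- The absolute value makes `w` nonnegative everywhere, as `labelSum` needs, without changing its
  -- law on `(0, 1]`.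
  refine ⟨fun x => (g ((x : EuclideanSpace ℝ (Fin d)) i)).1, fun x =>
    |(g ((x : EuclideanSpace ℝ (Fin d)) i)).2|, by fun_prop, by fun_prop,
    fun x => abs_nonneg _, ?_⟩
  have habs : Measurable (Prod.map id (fun t : ℝ => |t|) : ℝ × ℝ → ℝ × ℝ) := by fun_prop
  have hI : (volume.restrict (Set.Ioc (0 : ℝ) 1)).map (fun t : ℝ => |t|)
      = volume.restrict (Set.Ioc (0 : ℝ) 1) := by
    refine (Measure.map_congr (g := id) ?_).trans Measure.map_id
    filter_upwards [ae_restrict_mem measurableSet_Ioc] with t ht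
    exact abs_of_pos ht.1
  rw [Measure.map_map hg hm] at hgτ
  calc _ = (ρ.map (g ∘ fun x : S => (x : EuclideanSpace ℝ (Fin d)) i)).map
        (Prod.map id (fun t : ℝ => |t|)) := (Measure.map_map habs (hg.comp hm)).symm
    _ = _ := by
      rw [hgτ, ← Measure.map_prod_map _ _ measurable_id (by fun_prop), Measure.map_id, hI]

/-! ### The law of a point process is determined by its counts -/

section

variable {d : ℕ} {S : Set (EuclideanSpace ℝ (Fin d))}

lemma SimplePointMeasure.measurable_apply {B : Set S} (hB : MeasurableSet B) :
    Measurable fun ν : SimplePointMeasure S => ν.1 B :=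
  (Measure.measurable_coe hB).comp measurable_subtype_coe

lemma SimplePointMeasure.measurable_mk {α : Type*} [MeasurableSpace α]
    {F : α → SimplePointMeasure S}
    (hF : ∀ B : Set S, MeasurableSet B → Measurable fun a => (F a).1 B) : Measurable F :=
  (Measure.measurable_of_measurable_coe (fun a => (F a).1) hF).subtype_mk

/-- The law of a random simple point measure is determined by the joint laws of the numbers of
points in finitely many sets. -/
lemma SimplePointMeasure.ext_of_finite_marginals {μ μ' : Measure (SimplePointMeasure S)}
    [IsFiniteMeasure μ] [IsFiniteMeasure μ']
    (h : ∀ I : Finset {B : Set S // MeasurableSet B},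
      μ.map (fun ν (B : I) => ν.1 B.1.1) = μ'.map (fun ν (B : I) => ν.1 B.1.1)) : μ = μ' := by
  let ev : SimplePointMeasure S → ({B : Set S // MeasurableSet B} → ℝ≥0∞) := fun ν B => ν.1 B.1
  have hev : Measurable ev := measurable_pi_lambda _ fun B => measurable_apply B.2
  have key : μ.map ev = μ'.map ev := by
    refine IsProjectiveLimit.unique
      (P := fun I => μ.map (fun ν (B : I) => ν.1 B.1.1)) (fun I => ?_) (fun I => ?_)
    · rw [Measure.map_map (by fun_prop) hev]; rfl
    · rw [Measure.map_map (by fun_prop) hev]; exact (h I).symm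
  have hle : (inferInstance : MeasurableSpace (SimplePointMeasure S)) ≤
      MeasurableSpace.comap ev inferInstance := by
    have : @Measurable _ _ (MeasurableSpace.comap ev inferInstance) inferInstance
        (id : SimplePointMeasure S → SimplePointMeasure S) := by
      refine @SimplePointMeasure.measurable_mk _ _ _ (MeasurableSpace.comap ev inferInstance) _
        fun B hB => ?_
      exact (measurable_pi_apply (⟨B, hB⟩ : {B : Set S // MeasurableSet B})).comp
        (comap_measurable ev)
    exact fun E hE => this hE
  ext E hE
  obtain ⟨F, hF, rfl⟩ := hle E hE
  rw [← Measure.map_apply hev hF, key, Measure.map_apply hev hF]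

section Counts

variable {Ω : Type*} [MeasurableSpace Ω] {P : Measure Ω} {N : Ω → SimplePointMeasure S} {c : ℝ≥0}

lemma IsPoissonProcess.hasLaw_pi (hN : IsPoissonProcess N c P) {ι : Type*} [Fintype ι]
    {B : ι → Set S} (hB : ∀ i, MeasurableSet (B i))
    (hd : Pairwise fun i j => Disjoint (B i) (B j)) :
    HasLaw (fun ω i => (N ω).1 (B i)) (Measure.pi fun i =>
      (poissonMeasure (c * (volume (Subtype.val '' B i)).toNNReal)).map (Nat.cast : ℕ → ℝ≥0∞))
      P := by
  refine iIndepFun.hasLaw_pi (fun i => hN.hasLaw_count (B i) (hB i)) ?_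
  let e := Fintype.equivFin ι
  have := (hN.indep_count _ (fun k => B (e.symm k)) (fun k => hB _)
    fun i j hij => hd (e.symm.injective.ne hij)).precomp e.injective
  simpa using this

lemma isPoissonProcess_of_hasLaw_pi [IsProbabilityMeasure P] (hN : Measurable N)
    (h : ∀ (n : ℕ) (B : Fin n → Set S), (∀ i, MeasurableSet (B i)) →
      Pairwise (fun i j => Disjoint (B i) (B j)) →
      HasLaw (fun ω i => (N ω).1 (B i)) (Measure.pi fun i =>
        (poissonMeasure (c * (volume (Subtype.val '' B i)).toNNReal)).map (Nat.cast : ℕ → ℝ≥0∞))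
        P) : IsPoissonProcess N c P := by
  have prob : ∀ r : ℝ≥0, IsProbabilityMeasure ((poissonMeasure r).map (Nat.cast : ℕ → ℝ≥0∞)) :=
    fun r => Measure.isProbabilityMeasure_map (by fun_prop)
  have count : ∀ B : Set S, MeasurableSet B → HasLaw (fun ω => (N ω).1 B)
      ((poissonMeasure (c * (volume (Subtype.val '' B)).toNNReal)).map (Nat.cast : ℕ → ℝ≥0∞))
      P := fun B hB =>
    (measurePreserving_eval (fun _ : Fin 1 => (poissonMeasure
        (c * (volume (Subtype.val '' B)).toNNReal)).map (Nat.cast : ℕ → ℝ≥0∞)) 0).fun_comp_hasLaw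
      (h 1 (fun _ => B) (fun _ => hB) fun i j hij => absurd (Subsingleton.elim i j) hij)
  refine ⟨hN, count, fun n B hB hd => ?_⟩
  exact (iIndepFun_iff_hasLaw_pi_pi fun i => count (B i) (hB i)).2 (h n B hB hd)

/-- The numbers of points in arbitrary sets are sums of numbers of points in the atoms of the
generated partition. -/
lemma exists_partition_sum {ι : Type*} [Fintype ι] [DecidableEq ι] {B : ι → Set S}
    (hB : ∀ i, MeasurableSet (B i)) :
    ∃ A : (ι → Bool) → Set S, (∀ b, MeasurableSet (A b)) ∧
      Pairwise (fun b b' => Disjoint (A b) (A b')) ∧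
      ∀ (ν : Measure S) (i : ι), ν (B i) = ∑ b, if b i then ν (A b) else 0 := by
  classical
  have meas : ∀ b : ι → Bool, MeasurableSet {x | ∀ i, decide (x ∈ B i) = b i} := fun b => by
    rw [Set.ofPred_forall]
    refine MeasurableSet.iInter fun i => ?_
    cases b i
    · simp only [decide_eq_false_iff_not]
      exact (hB i).compl
    · simpa using hB i
  have disj : Pairwise fun b b' : ι → Bool => Disjoint {x | ∀ i, decide (x ∈ B i) = b i}
      {x | ∀ i, decide (x ∈ B i) = b' i} := fun b b' hbb' => by
    refine Set.disjoint_left.2 ?_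
    intro x hx hx'
    exact hbb' (funext fun i => (hx i).symm.trans (hx' i))
  refine ⟨fun b => {x | ∀ i, decide (x ∈ B i) = b i}, meas, disj, fun ν i => ?_⟩
  rw [← Finset.sum_filter, ← measure_biUnion_finset (fun b _ b' _ h => disj h) fun b _ => meas b]
  congr 1
  ext x
  simp only [Finset.mem_filter, Finset.mem_univ, true_and, Set.mem_iUnion, exists_prop]
  constructor
  · exact fun hx => ⟨fun i => decide (x ∈ B i), by simpa using hx, fun _ => rfl⟩
  · rintro ⟨b, hb, hx⟩
    simpa [hb] using hx i

/-- Counts of arbitrary sets are a fixed linear function of the counts of disjoint atoms, whose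
joint law the definition prescribes. -/
lemma IsPoissonProcess.map_eq_map {Ω' : Type*} [MeasurableSpace Ω'] {P' : Measure Ω'}
    [IsProbabilityMeasure P] [IsProbabilityMeasure P']
    {N' : Ω' → SimplePointMeasure S} (hN : IsPoissonProcess N c P)
    (hN' : IsPoissonProcess N' c P') : P.map N = P'.map N' := by
  have := Measure.isProbabilityMeasure_map (μ := P) hN.measurable.aemeasurable
  have := Measure.isProbabilityMeasure_map (μ := P') hN'.measurable.aemeasurable
  classical
  refine SimplePointMeasure.ext_of_finite_marginals fun I => ?_
  obtain ⟨A, hA, hd, hsum⟩ := exists_partition_sum (B := fun B : I => B.1.1) fun B => B.1.2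
  have hL : Measurable fun (z : (I → Bool) → ℝ≥0∞) (i : I) => ∑ b, if b i then z b else 0 := by
    refine measurable_pi_lambda _ fun i => Finset.measurable_fun_sum _ fun b _ => ?_
    split_ifs <;> fun_prop
  have hI : Measurable fun (ν : SimplePointMeasure S) (B : I) => ν.1 B.1.1 :=
    measurable_pi_lambda _ fun B => SimplePointMeasure.measurable_apply B.1.2
  rw [Measure.map_map hI hN.measurable, Measure.map_map hI hN'.measurable]
  have e1 := (hN.hasLaw_pi hA hd).map_eq
  have e2 := (hN'.hasLaw_pi hA hd).map_eq
  have m1 : Measurable fun ω b => (N ω).1 (A b) := measurable_pi_lambda _ fun b =>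
    (SimplePointMeasure.measurable_apply (hA b)).comp hN.measurable
  have m2 : Measurable fun ω b => (N' ω).1 (A b) := measurable_pi_lambda _ fun b =>
    (SimplePointMeasure.measurable_apply (hA b)).comp hN'.measurable
  have := congrArg (fun μ => μ.map
    fun (z : (I → Bool) → ℝ≥0∞) (i : I) => ∑ b, if b i then z b else 0) (e1.trans e2.symm)
  rw [Measure.map_map hL m1, Measure.map_map hL m2] at this
  convert this using 2 <;>
  · funext ω B
    exact hsum _ B

end Counts

end

/-! ### Poisson processes as samples of Poisson size -/

section

variable {d : ℕ} {S : Set (EuclideanSpace ℝ (Fin d))}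

lemma isSimplePointMeasure_sum_dirac {ι : Type*} [Fintype ι] {x : ι → S}
    (hx : Function.Injective x) : IsSimplePointMeasure (∑ i, Measure.dirac (x i)) := by
  refine ⟨Set.range x, fun r => (Set.finite_range x).subset fun y hy => hy.1, ?_⟩
  rw [← Measure.sum_fintype]
  ext B hB
  rw [Measure.sum_apply _ hB, Measure.sum_apply _ hB]
  exact (Equiv.ofInjective x hx).tsum_eq fun a : Set.range x => Measure.dirac (a : S) B

lemma isSimplePointMeasure_zero : IsSimplePointMeasure (0 : Measure S) := by
  refine ⟨∅, fun r => by simp, ?_⟩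
  rw [Measure.sum_of_isEmpty]

open Classical in
/-- The simple point measure of a tuple of distinct points (and the null measure for a tuple with
repetitions). -/
noncomputable def tuplePointMeasure {ι : Type*} [Fintype ι] (x : ι → S) : SimplePointMeasure S :=
  if h : Function.Injective x then ⟨∑ i, Measure.dirac (x i), isSimplePointMeasure_sum_dirac h⟩
  else ⟨0, isSimplePointMeasure_zero⟩

lemma tuplePointMeasure_val {ι : Type*} [Fintype ι] {x : ι → S} (hx : Function.Injective x) :
    (tuplePointMeasure x).1 = ∑ i, Measure.dirac (x i) := by
  rw [tuplePointMeasure, dif_pos hx]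

lemma tuplePointMeasure_apply {ι : Type*} [Fintype ι] {x : ι → S} (hx : Function.Injective x)
    {B : Set S} (hB : MeasurableSet B) :
    (tuplePointMeasure x).1 B = ∑ i, B.indicator 1 (x i) := by
  simp [tuplePointMeasure_val hx, Measure.dirac_apply' _ hB]

lemma tuplePointMeasure_comp_equiv {ι κ : Type*} [Fintype ι] [Fintype κ] (e : κ ≃ ι) (x : ι → S) :
    tuplePointMeasure (x ∘ e) = tuplePointMeasure x := by
  apply Subtype.ext
  by_cases hx : Function.Injective x
  · rw [tuplePointMeasure_val hx, tuplePointMeasure_val (hx.comp e.injective)]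
    exact e.sum_comp fun i => Measure.dirac (x i)
  · have hx' : ¬ Function.Injective (x ∘ e) := fun h => hx (by
      simpa [Function.comp_assoc] using h.comp e.symm.injective)
    rw [tuplePointMeasure, tuplePointMeasure, dif_neg hx, dif_neg hx']

lemma measurableSet_injective {ι β : Type*} [Finite ι] [MeasurableSpace β] [MeasurableEq β] :
    MeasurableSet {x : ι → β | Function.Injective x} := by
  have : {x : ι → β | Function.Injective x} =
      ⋂ i, ⋂ j, {x : ι → β | x i = x j → i = j} := by
    ext x; simp [Function.Injective]
  rw [this]
  refine MeasurableSet.iInter fun i => MeasurableSet.iInter fun j => ?_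
  by_cases hij : i = j
  · simp [hij]
  · simp only [hij, imp_false]
    exact (measurableSet_eq_fun (measurable_pi_apply i) (measurable_pi_apply j)).compl

lemma measurable_tuplePointMeasure {ι : Type*} [Fintype ι] :
    Measurable (tuplePointMeasure : (ι → S) → SimplePointMeasure S) := by
  classical
  refine SimplePointMeasure.measurable_mk fun B hB => ?_
  have : (fun x : ι → S => (tuplePointMeasure x).1 B) =
      {x : ι → S | Function.Injective x}.indicator fun x => ∑ i, B.indicator 1 (x i) := by
    funext x
    by_cases hx : Function.Injective x
    · rw [tuplePointMeasure_apply hx hB]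
      rw [Set.indicator_of_mem (s := {x : ι → S | Function.Injective x}) hx]
    · rw [Set.indicator_of_notMem (s := {x : ι → S | Function.Injective x}) hx,
        tuplePointMeasure, dif_neg hx]
      simp
  rw [this]
  refine Measurable.indicator (Finset.measurable_fun_sum _ fun i _ => ?_) measurableSet_injective
  exact (measurable_one.indicator hB).comp (measurable_pi_apply i)

/-- Independent samples of a label with atomless law are distinct. -/
lemma ae_injective_comp {ι α β : Type*} [Fintype ι] [MeasurableSpace α] [MeasurableSpace β]
    [MeasurableEq β] (ρ : Measure α) [IsProbabilityMeasure ρ] {g : α → β} (hg : Measurable g)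
    (h : ∀ b, ρ (g ⁻¹' {b}) = 0) :
    ∀ᵐ x ∂Measure.pi (fun _ : ι => ρ), Function.Injective (g ∘ x) := by
  classical
  have key : ∀ i j : ι, i ≠ j → ∀ᵐ x ∂Measure.pi (fun _ : ι => ρ), g (x i) ≠ g (x j) := by
    intro i j hij
    have hm : MeasurableSet {x : ι → α | g (x i) = g (x j)} :=
      measurableSet_eq_fun (by fun_prop) (by fun_prop)
    rw [ae_iff]
    simp only [ne_eq, not_not]
    rw [← lintegral_indicator_one hm]
    have hf : Measurable ({x : ι → α | g (x i) = g (x j)}.indicator (1 : (ι → α) → ℝ≥0∞)) :=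
      measurable_one.indicator hm
    by_cases hne : Nonempty (ι → α)
    swap
    · rw [not_nonempty_iff] at hne
      simp
    -- Integrate over the coordinate `i` first: with the others fixed, a coincidence confines `x i`
    -- to a single null fibre of `g`.
    rw [lintegral_eq_lmarginal_univ hne.some, lmarginal_erase' _ hf (Finset.mem_univ i)]
    have : (fun x : ι → α => ∫⁻ y, {x : ι → α | g (x i) = g (x j)}.indicator (1 : (ι → α) → ℝ≥0∞)
        (Function.update x i y) ∂ρ) = 0 := by
      funext x
      have : ∀ y, {x : ι → α | g (x i) = g (x j)}.indicator (1 : (ι → α) → ℝ≥0∞)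
          (Function.update x i y) = (g ⁻¹' {g (x j)}).indicator 1 y := fun y => by
        simp [Set.indicator, Function.update_of_ne hij.symm]
      simp_rw [this]
      rw [Pi.zero_apply]
      refine le_antisymm ((lintegral_indicator_one_le _).trans (h _).le) zero_le
    rw [this]
    simp [lmarginal]
  have key' : ∀ᵐ x ∂Measure.pi (fun _ : ι => ρ), ∀ i j : ι, i ≠ j → g (x i) ≠ g (x j) := by
    simp_rw [ae_all_iff]
    exact key
  filter_upwards [key'] with x hx i j hij
  by_contra hne
  exact hx i j hne hij

/-- The law of `n` independent points with law `ρ`, as a random simple point measure. -/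
noncomputable def sampleLaw (ρ : Measure S) (n : ℕ) : Measure (SimplePointMeasure S) :=
  (Measure.pi fun _ : Fin n => ρ).map tuplePointMeasure

/-- The law of a Poisson number of independent points with law `ρ`. -/
noncomputable def poissonSampleLaw (ρ : Measure S) (a : ℝ≥0) : Measure (SimplePointMeasure S) :=
  Measure.sum fun n => poissonMeasure a {n} • sampleLaw ρ n

variable (ρ : Measure S) [IsProbabilityMeasure ρ]

instance (n : ℕ) : IsProbabilityMeasure (sampleLaw ρ n) :=
  Measure.isProbabilityMeasure_map measurable_tuplePointMeasure.aemeasurable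

lemma tsum_measure_singleton (μ : Measure ℕ) : ∑' n, μ {n} = μ Set.univ := by
  rw [← measure_iUnion (fun i j h => by simpa using h) fun n => measurableSet_singleton n,
    Set.iUnion_of_singleton]

instance (a : ℝ≥0) : IsProbabilityMeasure (poissonSampleLaw ρ a) := ⟨by
  rw [poissonSampleLaw, Measure.sum_apply _ MeasurableSet.univ]
  simp [tsum_measure_singleton]⟩

end

section

variable {d : ℕ} {S : Set (EuclideanSpace ℝ (Fin d))} (ρ : Measure S) [IsProbabilityMeasure ρ]

lemma ae_injective [NullSingletonClass ρ] {ι : Type*} [Fintype ι] :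
    ∀ᵐ x ∂Measure.pi (fun _ : ι => ρ), Function.Injective x :=
  ae_injective_comp ρ measurable_id fun b => by simp

-- A point lies in at most one `B j`, so the exponential of the sum is affine in the indicators.
open Complex in
lemma integral_cexp_indicator_sum {m : ℕ} {B : Fin m → Set S}
    (hB : ∀ i, MeasurableSet (B i)) (hd : Pairwise fun i j => Disjoint (B i) (B j))
    (t : Fin m → ℝ) :
    ∫ y, cexp ((∑ j, (B j).indicator (fun _ => t j) y : ℝ) * I) ∂ρ
      = 1 + ∑ j, (ρ.real (B j) : ℂ) * (cexp (t j * I) - 1) := by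
  have h : ∀ y, cexp ((∑ j, (B j).indicator (fun _ => t j) y : ℝ) * I)
      = 1 + ∑ j, (B j).indicator (fun _ => cexp (t j * I) - 1) y := by
    intro y
    by_cases hy : ∃ i, y ∈ B i
    · obtain ⟨i, hi⟩ := hy
      have hne : ∀ j, j ≠ i → y ∉ B j := fun j hj hyj =>
        Set.disjoint_left.1 (hd hj) hyj hi
      rw [Finset.sum_eq_single i (fun j _ hj => Set.indicator_of_notMem (hne j hj) _) (by simp),
        Finset.sum_eq_single i (fun j _ hj => Set.indicator_of_notMem (hne j hj) _) (by simp)]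
      simp [hi]
    · push Not at hy
      simp [hy]
  simp_rw [h]
  have hint : ∀ j, Integrable ((B j).indicator fun _ => cexp (t j * I) - 1) ρ := fun j =>
    (integrable_const _).indicator (hB j)
  rw [integral_add (integrable_const _) (integrable_finsetSum _ fun j _ => hint j),
    integral_finsetSum _ fun j _ => hint j]
  simp [integral_indicator_const, hB]

-- By characteristic functions: `n` independent points contribute `z ^ n`, and averaging over a
-- Poisson number gives `exp (a (z - 1))`. Since `z - 1` is a sum over `j`, this factorises into
-- Poisson characteristic functions.
open Complex in
lemma hasLaw_toReal_poissonSampleLaw [NullSingletonClass ρ] (a : ℝ≥0) {m : ℕ} {B : Fin m → Set S}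
    (hB : ∀ i, MeasurableSet (B i)) (hd : Pairwise fun i j => Disjoint (B i) (B j)) :
    HasLaw (fun (ν : SimplePointMeasure S) i => (ν.1 (B i)).toReal) (Measure.pi fun i =>
      (poissonMeasure (a * (ρ (B i)).toNNReal)).map (Nat.cast : ℕ → ℝ))
      (poissonSampleLaw ρ a) := by
  have hm : Measurable (fun (ν : SimplePointMeasure S) i => (ν.1 (B i)).toReal) :=
    measurable_pi_lambda _ fun i => (SimplePointMeasure.measurable_apply (hB i)).ennreal_toReal
  refine ⟨hm.aemeasurable, ?_⟩
  have prob : ∀ r : ℝ≥0, IsProbabilityMeasure ((poissonMeasure r).map (Nat.cast : ℕ → ℝ)) :=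
    fun r => Measure.isProbabilityMeasure_map (by fun_prop)
  have := Measure.isProbabilityMeasure_map (μ := poissonSampleLaw ρ a) hm.aemeasurable
  rw [← charFun_eq_pi_iff]
  intro t
  simp_rw [charFun_map_cast_poissonMeasure]
  rw [charFun_apply, integral_map (by fun_prop) (by fun_prop),
    integral_map hm.aemeasurable (by fun_prop)]
  have hexp : ∀ ν : SimplePointMeasure S, cexp (inner ℝ (WithLp.toLp 2
      fun i => (ν.1 (B i)).toReal) t * I) = cexp ((∑ j, (ν.1 (B j)).toReal * t j : ℝ) * I) := by
    intro ν
    simp [PiLp.inner_apply, mul_comm]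
  simp_rw [hexp]
  set F : SimplePointMeasure S → ℂ := fun ν => cexp ((∑ j, (ν.1 (B j)).toReal * t j : ℝ) * I)
    with hF
  have hFm : Measurable F := by
    have : ∀ j, Measurable fun ν : SimplePointMeasure S => (ν.1 (B j)).toReal :=
      fun j => (SimplePointMeasure.measurable_apply (hB j)).ennreal_toReal
    fun_prop
  have hFb : ∀ ν, ‖F ν‖ ≤ 1 := fun ν => (norm_exp_ofReal_mul_I _).le
  set z : ℂ := 1 + ∑ j, (ρ.real (B j) : ℂ) * (cexp (t j * I) - 1) with hz
  have hsample : ∀ n, ∫ ν, F ν ∂sampleLaw ρ n = z ^ n := by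
    intro n
    rw [sampleLaw, integral_map measurable_tuplePointMeasure.aemeasurable
      hFm.aestronglyMeasurable, hz, ← integral_cexp_indicator_sum ρ hB hd (fun j => t j)]
    have hpow := integral_fintype_prod_eq_pow (μ := ρ) (ι := Fin n)
      fun y => cexp ((∑ j, (B j).indicator (fun _ => t j) y : ℝ) * I)
    rw [Fintype.card_fin] at hpow
    rw [← hpow]
    refine integral_congr_ae ?_
    filter_upwards [ae_injective ρ (ι := Fin n)] with x hx
    simp only [hF]
    rw [← exp_sum, ← Finset.sum_mul, ← ofReal_sum]
    congr 3
    rw [Finset.sum_comm]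
    refine Finset.sum_congr rfl fun j _ => ?_
    rw [tuplePointMeasure_apply hx (hB j), ENNReal.toReal_sum, Finset.sum_mul]
    · refine Finset.sum_congr rfl fun i _ => ?_
      by_cases hi : x i ∈ B j <;> simp [hi]
    · intro i _
      by_cases hi : x i ∈ B j <;> simp [hi]
  have h1 : HasSum (fun n => (Real.exp (-a) * a ^ n / n.factorial : ℂ) * z ^ n)
      (∫ ν, F ν ∂poissonSampleLaw ρ a) := by
    have := hasSum_integral_measure (f := F) (μ := fun n => poissonMeasure a {n} • sampleLaw ρ n)
      (Integrable.of_bound (μ := poissonSampleLaw ρ a) hFm.aestronglyMeasurable 1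
        (Filter.Eventually.of_forall hFb))
    refine (funext fun n => ?_ : (fun n => (Real.exp (-a) * a ^ n / n.factorial : ℂ) * z ^ n) = _)
      ▸ this
    rw [integral_smul_measure, hsample, ← measureReal_def, poissonMeasure_real_singleton]
    simp
  have h2 : HasSum (fun n => (Real.exp (-a) * a ^ n / n.factorial : ℂ) * z ^ n)
      (cexp (a * (z - 1))) := by
    have := (NormedSpace.expSeries_div_hasSum_exp (a * z)).mul_left (cexp (-a))
    rw [← exp_eq_exp_ℂ, ← Complex.exp_add] at this
    rw [show (a : ℂ) * (z - 1) = -a + a * z by ring]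
    refine (funext fun n => ?_ : (fun n => (Real.exp (-a) * a ^ n / n.factorial : ℂ) * z ^ n) = _)
      ▸ this
    push_cast
    rw [mul_pow]
    ring
  rw [h1.unique h2, ← exp_sum, hz]
  congr 1
  rw [add_sub_cancel_left, Finset.mul_sum]
  refine Finset.sum_congr rfl fun j _ => ?_
  rw [← mul_assoc]
  congr 1
  push_cast
  rfl

lemma ae_poissonSampleLaw_lt_top [NullSingletonClass ρ] (a : ℝ≥0) :
    ∀ᵐ ν ∂poissonSampleLaw ρ a, ν.1 Set.univ < ⊤ := by
  rw [poissonSampleLaw, Measure.ae_sum_iff]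
  intro n
  refine Measure.ae_smul_measure ?_ _
  rw [sampleLaw, ae_map_iff measurable_tuplePointMeasure.aemeasurable
    (measurableSet_lt (SimplePointMeasure.measurable_apply MeasurableSet.univ) measurable_const)]
  filter_upwards [ae_injective ρ (ι := Fin n)] with x hx
  rw [tuplePointMeasure_apply hx MeasurableSet.univ]
  simp

/-- Total mass is almost surely finite, so passing to real counts loses nothing. -/
lemma hasLaw_poissonSampleLaw [NullSingletonClass ρ] (a : ℝ≥0) {m : ℕ} {B : Fin m → Set S}
    (hB : ∀ i, MeasurableSet (B i)) (hd : Pairwise fun i j => Disjoint (B i) (B j)) :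
    HasLaw (fun (ν : SimplePointMeasure S) i => ν.1 (B i)) (Measure.pi fun i =>
      (poissonMeasure (a * (ρ (B i)).toNNReal)).map (Nat.cast : ℕ → ℝ≥0∞))
      (poissonSampleLaw ρ a) := by
  have prob : ∀ r : ℝ≥0, IsProbabilityMeasure ((poissonMeasure r).map (Nat.cast : ℕ → ℝ)) :=
    fun r => Measure.isProbabilityMeasure_map (by fun_prop)
  have h := hasLaw_toReal_poissonSampleLaw ρ a hB hd
  have hmap : ∀ r : ℝ≥0, ((poissonMeasure r).map (Nat.cast : ℕ → ℝ)).map ENNReal.ofReal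
      = (poissonMeasure r).map (Nat.cast : ℕ → ℝ≥0∞) := fun r => by
    rw [Measure.map_map (by fun_prop) (by fun_prop)]
    congr 1
    funext n
    simp
  have hpi : HasLaw (fun (z : Fin m → ℝ) i => ENNReal.ofReal (z i)) (Measure.pi fun i =>
      (poissonMeasure (a * (ρ (B i)).toNNReal)).map (Nat.cast : ℕ → ℝ≥0∞)) (Measure.pi fun i =>
      (poissonMeasure (a * (ρ (B i)).toNNReal)).map (Nat.cast : ℕ → ℝ)) := by
    refine ⟨(measurable_pi_lambda _ fun i => by fun_prop).aemeasurable, ?_⟩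
    simp_rw [← hmap]
    exact Measure.pi_map_pi (fun i => by fun_prop)
  refine (hpi.comp h).congr ?_
  filter_upwards [ae_poissonSampleLaw_lt_top ρ a] with ν hν
  funext i
  simp only [Function.comp_apply]
  rw [ENNReal.ofReal_toReal]
  exact ((measure_mono (Set.subset_univ _)).trans_lt hν).ne

end

section

variable {d : ℕ} {S : Set (EuclideanSpace ℝ (Fin d))}

/-- The uniform distribution on a set of positive finite volume. -/
noncomputable def uniformMeasure (S : Set (EuclideanSpace ℝ (Fin d))) : Measure S :=
  (volume S)⁻¹ • volume.comap Subtype.val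

lemma isProbabilityMeasure_uniformMeasure (hS : MeasurableSet S) (h0 : 0 < volume S)
    (hfin : volume S < ⊤) : IsProbabilityMeasure (uniformMeasure S) := ⟨by
  rw [uniformMeasure, Measure.smul_apply, comap_subtype_coe_apply hS, Set.image_univ,
    Subtype.range_coe, smul_eq_mul, ENNReal.inv_mul_cancel h0.ne' hfin.ne]⟩

lemma uniformMeasure_absolutelyContinuous :
    uniformMeasure S ≪ volume.comap Subtype.val :=
  Measure.AbsolutelyContinuous.rfl.smul_left _

lemma mul_toNNReal_volume_image (hS : MeasurableSet S) (h0 : 0 < volume S)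
    (hfin : volume S < ⊤) (c : ℝ≥0) (B : Set S) :
    c * (volume (Subtype.val '' B)).toNNReal
      = c * (volume S).toNNReal * (uniformMeasure S B).toNNReal := by
  rw [uniformMeasure, Measure.smul_apply, comap_subtype_coe_apply hS, smul_eq_mul,
    ENNReal.toNNReal_mul, mul_assoc, ← mul_assoc (volume S).toNNReal, ← ENNReal.toNNReal_mul,
    ENNReal.mul_inv_cancel h0.ne' hfin.ne, ENNReal.toNNReal_one, one_mul]

/-- Poisson processes of intensity `c` are exactly the random simple point measures distributed
like a Poisson number of independent uniform points. -/
lemma isPoissonProcess_iff_map_eq (hS : MeasurableSet S) (h0 : 0 < volume S)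
    (hfin : volume S < ⊤) [NullSingletonClass (uniformMeasure S)] {Ω : Type*} [MeasurableSpace Ω]
    {P : Measure Ω} [IsProbabilityMeasure P] {N : Ω → SimplePointMeasure S} {c : ℝ≥0} :
    IsPoissonProcess N c P ↔ Measurable N ∧
      P.map N = poissonSampleLaw (uniformMeasure S) (c * (volume S).toNNReal) := by
  have := isProbabilityMeasure_uniformMeasure hS h0 hfin
  have key : ∀ (n : ℕ) (B : Fin n → Set S), (∀ i, MeasurableSet (B i)) →
      Pairwise (fun i j => Disjoint (B i) (B j)) →
      HasLaw (fun (ν : SimplePointMeasure S) i => ν.1 (B i)) (Measure.pi fun i =>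
        (poissonMeasure (c * (volume (Subtype.val '' B i)).toNNReal)).map (Nat.cast : ℕ → ℝ≥0∞))
        (poissonSampleLaw (uniformMeasure S) (c * (volume S).toNNReal)) := fun n B hB hd => by
    simp_rw [mul_toNNReal_volume_image hS h0 hfin c]
    exact hasLaw_poissonSampleLaw _ _ hB hd
  constructor
  · intro hN
    refine ⟨hN.measurable, ?_⟩
    have hid : IsPoissonProcess id c
        (poissonSampleLaw (uniformMeasure S) (c * (volume S).toNNReal)) :=
      isPoissonProcess_of_hasLaw_pi measurable_id key
    rw [hN.map_eq_map hid, Measure.map_id]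
  · rintro ⟨hN, hmap⟩
    refine isPoissonProcess_of_hasLaw_pi hN fun n B hB hd => ?_
    exact (key n B hB hd).fun_comp ⟨hN.aemeasurable, hmap⟩

end

/-! ### Random sets of ranks -/

/-- The circle can be partitioned into pieces of prescribed lengths. -/
lemma exists_unitAddCircle_partition {β : Type*} [Countable β] {γ : β → ℝ≥0∞}
    (hγ : ∑' b, γ b = 1) :
    ∃ G : UnitAddCircle → β, (∀ b, MeasurableSet (G ⁻¹' {b})) ∧
      ∀ b, volume (G ⁻¹' {b}) = γ b := by
  let _ : MeasurableSpace β := ⊤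
  have : DiscreteMeasurableSpace β := ⟨fun _ => trivial⟩
  let τ : Measure β := Measure.sum fun b => γ b • Measure.dirac b
  have : IsProbabilityMeasure τ := ⟨by simp [τ, hγ]⟩
  obtain ⟨G, hG, hGτ⟩ := exists_measurable_map_eq_of_unitAddCircle τ
  refine ⟨G, fun b => hG (measurableSet_singleton b), fun b => ?_⟩
  rw [← Measure.map_apply hG (measurableSet_singleton b), hGτ, Measure.sum_smul_dirac_singleton]

open Finset in
/-- A random proper subset of `range n` on the circle, whose cardinality has a given law and which
is uniform given its cardinality. -/
lemma exists_random_ssubset {n : ℕ} {p : ℕ → ℝ≥0∞} (hp : ∑' j, p j = 1)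
    (hn : ∀ j, p j ≠ 0 → j < n) :
    ∃ G : UnitAddCircle → Finset ℕ, (∀ z, G z ⊂ range n) ∧ (∀ T, MeasurableSet (G ⁻¹' {T})) ∧
      ∀ T ⊂ range n, volume (G ⁻¹' {T}) = p #T / n.choose #T := by
  have hpn : p n = 0 := by
    by_contra h
    exact lt_irrefl _ (hn n h)
  -- Each of the `n.choose j` sets of size `j` receives an equal share of `p j`; the full set may be
  -- omitted because `p n = 0`.
  have hsum : ∑' T : {T // T ∈ (range n).ssubsets}, p #T.1 / n.choose #T.1 = 1 := by
    rw [Finset.tsum_subtype (range n).ssubsets fun T => p #T / n.choose #T, ssubsets,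
      sum_erase _ (by simp [hpn]), sum_powerset_apply_card fun j => p j / n.choose j, card_range,
      ← hp, tsum_eq_sum (s := range (n + 1))]
    · refine sum_congr rfl fun j hj => ?_
      have : n.choose j ≠ 0 := (Nat.choose_pos (by simp at hj; omega)).ne'
      rw [nsmul_eq_mul, ENNReal.mul_div_cancel (by exact_mod_cast this) (by simp)]
    · intro j hj
      by_contra h
      exact hj (mem_range.2 ((hn j h).trans (Nat.lt_succ_self n)))
  obtain ⟨G, hG, hGγ⟩ := exists_unitAddCircle_partition hsum
  refine ⟨fun z => (G z).1, fun z => mem_ssubsets.1 (G z).2, fun T => ?_, fun T hT => ?_⟩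
  · by_cases hT : T ⊂ range n
    · convert hG ⟨T, mem_ssubsets.2 hT⟩ using 1
      ext z
      simp [Subtype.ext_iff]
    · convert MeasurableSet.empty
      ext z
      simp only [Set.mem_preimage, Set.mem_singleton_iff, Set.mem_empty_iff_false, iff_false]
      rintro rfl
      exact hT (mem_ssubsets.1 (G z).2)
  · rw [← hGγ ⟨T, mem_ssubsets.2 hT⟩]
    congr 1
    ext z
    simp [Subtype.ext_iff]

/-- The rank of a coordinate of a tuple, ties being broken by the indices. -/
noncomputable def rankAmong {n : ℕ} (u : Fin n → ℝ) (i : Fin n) : ℕ :=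
  ∑ j, if u j < u i ∨ (u j = u i ∧ j < i) then 1 else 0

lemma rankAmong_eq_card {n : ℕ} (u : Fin n → ℝ) (i : Fin n) :
    rankAmong u i = (Finset.univ.filter fun j => u j < u i ∨ (u j = u i ∧ j < i)).card := by
  simp [rankAmong]

lemma rankAmong_lt {n : ℕ} (u : Fin n → ℝ) (i : Fin n) : rankAmong u i < n := by
  rw [rankAmong_eq_card]
  conv_rhs => rw [← Fintype.card_fin n, ← Finset.card_univ]
  exact Finset.card_lt_card (Finset.ssubset_univ_iff.2 fun h => by
    have := Finset.mem_univ i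
    rw [← h] at this
    simp at this)

lemma rankAmong_injective {n : ℕ} (u : Fin n → ℝ) : Function.Injective (rankAmong u) := by
  have key : ∀ i j, (u i < u j ∨ (u i = u j ∧ i < j)) → rankAmong u i < rankAmong u j := by
    intro i j hij
    rw [rankAmong_eq_card, rankAmong_eq_card]
    refine Finset.card_lt_card ((Finset.ssubset_iff_of_subset fun l hl => ?_).2 ⟨i, ?_, ?_⟩)
    · simp only [Finset.mem_filter, Finset.mem_univ, true_and] at hl ⊢
      rcases hl with hl | ⟨hl, hl'⟩ <;> rcases hij with hij | ⟨hij, hij'⟩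
      · exact Or.inl (hl.trans hij)
      · exact Or.inl (hij ▸ hl)
      · exact Or.inl (hl ▸ hij)
      · exact Or.inr ⟨hl.trans hij, hl'.trans hij'⟩
    · simpa using hij
    · simp
  intro i j hij
  by_contra hne
  rcases lt_trichotomy (u i) (u j) with h | h | h
  · exact (key i j (Or.inl h)).ne hij
  · rcases lt_or_gt_of_ne hne with h' | h'
    · exact (key i j (Or.inr ⟨h, h'⟩)).ne hij
    · exact (key j i (Or.inr ⟨h.symm, h'⟩)).ne hij.symm
  · exact (key j i (Or.inl h)).ne hij.symm

lemma rankAmong_of_injective {n : ℕ} {u : Fin n → ℝ} (hu : Function.Injective u) (i : Fin n) :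
    rankAmong u i = ∑ j, if u j < u i then 1 else 0 := by
  refine Finset.sum_congr rfl fun j _ => ?_
  have : ¬ (u j = u i ∧ j < i) := fun h => h.2.ne (hu h.1)
  simp [this]

lemma measurable_rankAmong {n : ℕ} :
    Measurable (rankAmong : (Fin n → ℝ) → Fin n → ℕ) := by
  refine measurable_pi_lambda _ fun i => Finset.measurable_fun_sum _ fun j _ => ?_
  refine Measurable.ite ?_ measurable_const measurable_const
  have h1 : MeasurableSet {u : Fin n → ℝ | u j < u i} :=
    measurableSet_lt (measurable_pi_apply j) (measurable_pi_apply i)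
  have h2 : MeasurableSet {u : Fin n → ℝ | u j = u i} :=
    measurableSet_eq_fun (measurable_pi_apply j) (measurable_pi_apply i)
  exact h1.union (h2.inter (MeasurableSet.const _))

-- Breaking ties makes this valid for every `u`. The decoupling argument uses it at each value of a
-- resampled label, not merely almost surely.
open Finset in
lemma image_rankAmong_univ {n : ℕ} (u : Fin n → ℝ) : univ.image (rankAmong u) = range n := by
  refine eq_of_subset_of_card_le (fun r hr => ?_) ?_
  · obtain ⟨i, _, rfl⟩ := mem_image.1 hr
    exact mem_range.2 (rankAmong_lt u i)
  · rw [card_image_of_injective _ (rankAmong_injective u)]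
    simp

open Finset in
lemma image_rankAmong_ssubset {n : ℕ} (u : Fin n → ℝ) {T : Finset (Fin n)} (hT : T ≠ univ) :
    T.image (rankAmong u) ⊂ range n := by
  rw [← image_rankAmong_univ u]
  exact image_ssubset_image (rankAmong_injective u) |>.2 (ssubset_univ_iff.2 hT)

open Finset in
lemma measurableSet_image_rankAmong {n : ℕ} (T : Finset (Fin n)) (R : Finset ℕ) :
    MeasurableSet {u : Fin n → ℝ | T.image (rankAmong u) = R} :=
  measurable_rankAmong (Set.to_countable {r : Fin n → ℕ | T.image r = R}).measurableSet

/-- Sampling the coordinates of a product along an injective map. -/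
lemma hasLaw_pi_comp_injective {ι κ α : Type*} [Fintype ι] [Fintype κ] [MeasurableSpace α]
    (ρ : Measure α) [IsProbabilityMeasure ρ] {e : κ → ι} (he : Function.Injective e) :
    HasLaw (fun (x : ι → α) k => x (e k)) (Measure.pi fun _ => ρ) (Measure.pi fun _ : ι => ρ) := by
  have h : ∀ i, HasLaw (fun x : ι → α => x i) ρ (Measure.pi fun _ : ι => ρ) := fun i =>
    (measurePreserving_eval (fun _ => ρ) i).hasLaw
  exact (((iIndepFun_iff_hasLaw_pi_pi h).2 HasLaw.id).precomp he).hasLaw_pi fun k => h (e k)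

/-! ### Thinning by ranks -/

section

variable {d : ℕ} {S : Set (EuclideanSpace ℝ (Fin d))}

lemma IsSimplePointMeasure.restrict {ν : Measure S} (hν : IsSimplePointMeasure ν) {K : Set S}
    (hK : MeasurableSet K) : IsSimplePointMeasure (ν.restrict K) := by
  obtain ⟨A, hA, rfl⟩ := hν
  refine ⟨A ∩ K, fun r => (hA r).subset fun x hx => ⟨hx.1.1, hx.2⟩, ?_⟩
  ext B hB
  rw [Measure.restrict_apply hB, Measure.sum_apply _ (hB.inter hK), Measure.sum_apply _ hB,
    tsum_subtype A fun a => Measure.dirac a (B ∩ K),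
    tsum_subtype (A ∩ K) fun a => Measure.dirac a B]
  refine tsum_congr fun a => ?_
  by_cases h1 : a ∈ A <;> by_cases h2 : a ∈ K <;> by_cases h3 : a ∈ B <;>
    simp [h1, h2, h3, hB, hB.inter hK]

variable (v w : S → ℝ) (G : ℕ → UnitAddCircle → Finset ℕ)

/-- The sum of the labels of the points of a configuration, modulo `1`. -/
noncomputable def labelSum (ν : Measure S) : UnitAddCircle :=
  ((∫⁻ y, ENNReal.ofReal (w y) ∂ν).toReal : ℝ)

/-- The points whose rank in a finite configuration `ν`, with respect to the order given by `v`,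
belongs to the set selected by the sum of the labels `w`. -/
def keptSet (ν : Measure S) : Set S :=
  {x | ∃ n : ℕ, ν Set.univ = n ∧ ∃ r ∈ G n (labelSum w ν), ν {y | v y < v x} = (r : ℕ)}

variable {v w G}

lemma measurable_measure_lt_comp (hv : Measurable v) (ν : Measure S) :
    Measurable fun x => ν {y | v y < v x} := by
  have : Monotone fun t : ℝ => ν {y | v y < t} := fun s t hst =>
    measure_mono fun y hy => lt_of_lt_of_le hy hst
  exact this.measurable.comp hv

lemma measurableSet_keptSet (hv : Measurable v) (ν : Measure S) :
    MeasurableSet (keptSet v w G ν) := by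
  have : keptSet v w G ν = ⋃ n : ℕ, ⋃ _ : ν Set.univ = n, ⋃ r ∈ G n (labelSum w ν),
      {x | ν {y | v y < v x} = (r : ℕ)} := by
    ext x
    simp [keptSet]
  rw [this]
  refine MeasurableSet.iUnion fun n => MeasurableSet.iUnion fun _ =>
    Finset.measurableSet_biUnion _ fun r _ => ?_
  exact measurable_measure_lt_comp hv ν (measurableSet_singleton _)

/-- The thinning that keeps the points of rank in a set selected by the sum of the labels. -/
noncomputable def rankThinning (hv : Measurable v) (w : S → ℝ)
    (G : ℕ → UnitAddCircle → Finset ℕ) (ν : SimplePointMeasure S) : SimplePointMeasure S :=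
  ⟨ν.1.restrict (keptSet v w G ν.1), ν.2.restrict (measurableSet_keptSet hv ν.1)⟩

lemma rankThinning_points_subset (hv : Measurable v) (ν : SimplePointMeasure S) :
    (rankThinning hv w G ν).points ⊆ ν.points := by
  intro x hx
  have h1 : ν.1.restrict (keptSet v w G ν.1) {x} = 1 := hx
  rw [Measure.restrict_apply (measurableSet_singleton x)] at h1
  by_cases hxK : x ∈ keptSet v w G ν.1
  · rwa [Set.inter_eq_left.2 (Set.singleton_subset_iff.2 hxK)] at h1
  · rw [Set.singleton_inter_eq_empty.2 hxK] at h1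
    simp at h1

lemma measurable_labelSum (hw : Measurable w) :
    Measurable fun ν : SimplePointMeasure S => labelSum w ν.1 :=
  measurable_coe_unitAddCircle.comp
    (((Measure.measurable_lintegral (by fun_prop)).comp measurable_subtype_coe).ennreal_toReal)

open Classical in
/-- The kernel of configurations with exactly `n` points. -/
noncomputable def countKernel (S : Set (EuclideanSpace ℝ (Fin d))) (n : ℕ) :
    Kernel (SimplePointMeasure S) S where
  toFun ν := if ν.1 Set.univ = n then ν.1 else 0
  measurable' := Measurable.ite
    (SimplePointMeasure.measurable_apply MeasurableSet.univ (measurableSet_singleton _))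
    measurable_subtype_coe measurable_const

lemma countKernel_of_eq {n : ℕ} {ν : SimplePointMeasure S} (h : ν.1 Set.univ = n) :
    countKernel S n ν = ν.1 := by
  simp [countKernel, h]

lemma countKernel_of_ne {n : ℕ} {ν : SimplePointMeasure S} (h : ν.1 Set.univ ≠ n) :
    countKernel S n ν = 0 := by
  simp [countKernel, h]

/-- Section measurability is applied to s-finite kernels; cutting by the number of points bounds the
otherwise unbounded masses. -/
instance (n : ℕ) : IsFiniteKernel (countKernel S n) := ⟨n, by simp, fun ν => by
  by_cases h : ν.1 Set.univ = n
  · rw [countKernel_of_eq h, h]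
  · rw [countKernel_of_ne h]; simp⟩

lemma measurable_rankThinning (hv : Measurable v) (hw : Measurable w)
    (hG : ∀ n T, MeasurableSet (G n ⁻¹' {T})) : Measurable (rankThinning hv w G) := by
  refine SimplePointMeasure.measurable_mk fun B hB => ?_
  let K : ℕ → Set (SimplePointMeasure S × S) := fun n => {q | ∃ T : Finset ℕ,
    G n (labelSum w q.1.1) = T ∧ ∃ r ∈ T, countKernel S n q.1 {y | v y < v q.2} = (r : ℕ)}
  have hrank : ∀ n, Measurable fun q : SimplePointMeasure S × S =>
      countKernel S n q.1 {y | v y < v q.2} := fun n => by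
    have ht : MeasurableSet {t : (SimplePointMeasure S × S) × S | v t.2 < v t.1.2} :=
      measurableSet_lt (by fun_prop) (by fun_prop)
    exact Kernel.measurable_kernel_prodMk_left
      (κ := (countKernel S n).comap Prod.fst measurable_fst) ht
  have hK : ∀ n, MeasurableSet (K n) := fun n => by
    have : K n = ⋃ T : Finset ℕ, {q | G n (labelSum w q.1.1) = T} ∩
        ⋃ r ∈ T, {q | countKernel S n q.1 {y | v y < v q.2} = (r : ℕ)} := by
      ext q
      simp [K]
    rw [this]
    refine MeasurableSet.iUnion fun T => MeasurableSet.inter ?_ ?_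
    · exact (measurable_labelSum hw).comp measurable_fst (hG n T)
    · exact Finset.measurableSet_biUnion _ fun r _ => hrank n (measurableSet_singleton _)
  -- At most the term indexed by the total mass survives; when that mass is not a natural number,
  -- nothing is kept and both sides vanish.
  have hsum : ∀ ν : SimplePointMeasure S, (rankThinning hv w G ν).1 B =
      ∑' n, countKernel S n ν (Prod.mk ν ⁻¹' (K n ∩ Prod.snd ⁻¹' B)) := by
    intro ν
    show ν.1.restrict (keptSet v w G ν.1) B = _
    rw [Measure.restrict_apply hB]
    by_cases h : ∃ m : ℕ, ν.1 Set.univ = m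
    · obtain ⟨m, hm⟩ := h
      rw [tsum_eq_single m]
      · rw [countKernel_of_eq hm]
        congr 1
        ext x
        simp [K, keptSet, hm, countKernel_of_eq hm, and_comm]
      · intro n hn
        rw [countKernel_of_ne fun h => hn (by exact_mod_cast h.symm.trans hm)]
        simp
    · have h0 : keptSet v w G ν.1 = ∅ := by
        ext x
        simp only [keptSet, Set.mem_ofPred_eq, Set.mem_empty_iff_false, iff_false]
        rintro ⟨n, hn, _⟩
        exact h ⟨n, hn⟩
      rw [h0, Set.inter_empty, measure_empty, eq_comm, ENNReal.tsum_eq_zero]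
      intro n
      rw [countKernel_of_ne fun hn => h ⟨n, hn⟩]
      simp
  simp_rw [hsum]
  exact Measurable.tsum fun n => Kernel.measurable_kernel_prodMk_left
    ((hK n).inter (measurable_snd hB))

open Finset in
/-- The effect of the thinning on a tuple with distinct labels. -/
lemma rankThinning_tuplePointMeasure (hv : Measurable v) (hw : Measurable w) (hw0 : ∀ y, 0 ≤ w y)
    {n : ℕ} {x : Fin n → S} (hx : Function.Injective (v ∘ x)) {T : Finset (Fin n)}
    (hT : ∀ i, i ∈ T ↔ rankAmong (v ∘ x) i ∈ G n ((∑ i, w (x i) : ℝ) : UnitAddCircle)) :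
    rankThinning hv w G (tuplePointMeasure x) = tuplePointMeasure fun i : T => x i := by
  have hxi : Function.Injective x := hx.of_comp
  have huniv : (tuplePointMeasure x).1 Set.univ = n := by
    rw [tuplePointMeasure_apply hxi MeasurableSet.univ]
    simp
  have hlabel : labelSum w (tuplePointMeasure x).1 = ((∑ i, w (x i) : ℝ) : UnitAddCircle) := by
    rw [labelSum, tuplePointMeasure_val hxi, lintegral_finsetSum_measure]
    simp_rw [lintegral_dirac' _ hw.ennreal_ofReal]
    rw [← ENNReal.ofReal_sum_of_nonneg fun i _ => hw0 _,
      ENNReal.toReal_ofReal (sum_nonneg fun i _ => hw0 _)]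
  have hrank : ∀ i, (tuplePointMeasure x).1 {y | v y < v (x i)} = (rankAmong (v ∘ x) i : ℕ) := by
    intro i
    rw [tuplePointMeasure_apply hxi (measurableSet_lt hv measurable_const),
      rankAmong_of_injective hx]
    push_cast
    refine sum_congr rfl fun j _ => ?_
    simp [Set.indicator]
  have hkept : ∀ i, x i ∈ keptSet v w G (tuplePointMeasure x).1 ↔ i ∈ T := by
    intro i
    rw [hT, keptSet, Set.mem_ofPred_eq]
    simp only [hrank, huniv, hlabel]
    constructor
    · rintro ⟨m, hm, r, hr, hri⟩
      rw [Nat.cast_inj] at hm hri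
      subst hm
      rwa [hri]
    · exact fun h => ⟨n, rfl, _, h, rfl⟩
  apply Subtype.ext
  show (tuplePointMeasure x).1.restrict _ = _
  ext B hB
  have hK := measurableSet_keptSet hv (w := w) (G := G) (tuplePointMeasure x).1
  rw [Measure.restrict_apply hB, tuplePointMeasure_apply hxi (hB.inter hK),
    tuplePointMeasure_apply (x := fun i : T => x i) (hxi.comp Subtype.val_injective) hB,
    sum_coe_sort T fun i => B.indicator (1 : S → ℝ≥0∞) (x i), ← sum_filter_add_sum_filter_not
      univ (fun i => i ∈ T)]
  simp only [filter_mem_eq_inter, univ_inter]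
  rw [sum_eq_zero (s := univ.filter fun i => i ∉ T), add_zero]
  · refine sum_congr rfl fun i hi => ?_
    by_cases hiB : x i ∈ B
    · rw [Set.indicator_of_mem hiB, Set.indicator_of_mem (Set.mem_inter hiB ((hkept i).2 hi))]
    · rw [Set.indicator_of_notMem hiB, Set.indicator_of_notMem fun h => hiB h.1]
  · intro i hi
    have : i ∉ T := by simpa using hi
    simp [hkept, this]

end

/-! ### Independence of the selection and the kept points -/

/-- A set selected by an independent uniform label, shifted on the circle by a constant. -/
lemma measure_eq_shifted_label {α β : Type*} [MeasurableSpace α] [Countable β] {ρ : Measure α}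
    {v w : α → ℝ} (hv : Measurable v) (hw : Measurable w)
    (hvw : ρ.map (fun x => (v x, w x)) =
      (volume.restrict (Set.Ioc (0 : ℝ) 1)).prod (volume.restrict (Set.Ioc (0 : ℝ) 1)))
    {G : UnitAddCircle → β} (hG : ∀ b, MeasurableSet (G ⁻¹' {b})) {R : ℝ → β}
    (hR : ∀ b, MeasurableSet (R ⁻¹' {b})) {γ : ℝ≥0∞} (hγ : ∀ t, volume (G ⁻¹' {R t}) = γ) (s : ℝ) :
    ρ {y | R (v y) = G ((w y + s : ℝ) : UnitAddCircle)} = γ := by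
  have hshift : Measurable fun u : ℝ => ((u + s : ℝ) : UnitAddCircle) :=
    measurable_coe_unitAddCircle.comp (by fun_prop)
  have hD : MeasurableSet {q : ℝ × ℝ | R q.1 = G ((q.2 + s : ℝ) : UnitAddCircle)} := by
    have : {q : ℝ × ℝ | R q.1 = G ((q.2 + s : ℝ) : UnitAddCircle)} =
        ⋃ b, (Prod.fst ⁻¹' (R ⁻¹' {b})) ∩
          (Prod.snd ⁻¹' ((fun u : ℝ => ((u + s : ℝ) : UnitAddCircle)) ⁻¹' (G ⁻¹' {b}))) := by
      ext q
      simp [eq_comm]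
    rw [this]
    exact MeasurableSet.iUnion fun b => (measurable_fst (hR b)).inter
      (measurable_snd (hshift (hG b)))
  have h1 := Measure.map_apply (μ := ρ) (hv.prodMk hw) hD
  rw [hvw, Measure.prod_apply hD] at h1
  refine h1.symm.trans ?_
  -- With `v` fixed at `t`, translation invariance on the circle absorbs the shift `s`, and by
  -- hypothesis the volume does not depend on `t`.
  have h2 : ∀ t, volume.restrict (Set.Ioc (0 : ℝ) 1) (Prod.mk t ⁻¹'
      {q : ℝ × ℝ | R q.1 = G ((q.2 + s : ℝ) : UnitAddCircle)}) = γ := by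
    intro t
    have hpres := UnitAddCircle.measurePreserving_mk 0
    rw [zero_add] at hpres
    have h3 : Prod.mk t ⁻¹' {q : ℝ × ℝ | R q.1 = G ((q.2 + s : ℝ) : UnitAddCircle)} =
        ((↑) : ℝ → UnitAddCircle) ⁻¹' ((fun z => z + (s : UnitAddCircle)) ⁻¹' (G ⁻¹' {R t})) := by
      ext u
      simp [eq_comm]
    rw [h3, hpres.measure_preimage ((measurable_add_const _ (hG _)).nullMeasurableSet),
      measure_preimage_add_right, hγ]
  simp_rw [h2]
  simp

section

variable {d : ℕ} {S : Set (EuclideanSpace ℝ (Fin d))} {ρ : Measure S} [IsProbabilityMeasure ρ]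
  {v w : S → ℝ}

open Finset in
lemma measurableSet_image_rankAmong_eq (hv : Measurable v) (hw : Measurable w) {n : ℕ}
    {G : UnitAddCircle → Finset ℕ} (hG : ∀ b, MeasurableSet (G ⁻¹' {b})) (T : Finset (Fin n)) :
    MeasurableSet {x : Fin n → S |
      T.image (rankAmong (v ∘ x)) = G ((∑ i, w (x i) : ℝ) : UnitAddCircle)} := by
  have hvx : Measurable fun x : Fin n → S => v ∘ x :=
    measurable_pi_lambda _ fun j => hv.comp (measurable_pi_apply j)
  have hwx : Measurable fun x : Fin n → S => ((∑ i, w (x i) : ℝ) : UnitAddCircle) :=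
    measurable_coe_unitAddCircle.comp (by fun_prop)
  have : {x : Fin n → S |
      T.image (rankAmong (v ∘ x)) = G ((∑ i, w (x i) : ℝ) : UnitAddCircle)} =
      ⋃ R : Finset ℕ, ((fun x => v ∘ x) ⁻¹' {u | T.image (rankAmong u) = R}) ∩
        ((fun x : Fin n → S => ((∑ i, w (x i) : ℝ) : UnitAddCircle)) ⁻¹' (G ⁻¹' {R})) := by
    ext x
    simp [eq_comm]
  rw [this]
  exact MeasurableSet.iUnion fun R =>
    (hvx (measurableSet_image_rankAmong T R)).inter (hwx (hG R))

open Finset in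
/-- Integrating out a point that is not kept, the selection of the kept points decouples from
their positions. -/
lemma measure_tuple_selected (hv : Measurable v) (hw : Measurable w)
    (hvw : ρ.map (fun x => (v x, w x)) =
      (volume.restrict (Set.Ioc (0 : ℝ) 1)).prod (volume.restrict (Set.Ioc (0 : ℝ) 1)))
    {n : ℕ} {G : UnitAddCircle → Finset ℕ} (hG : ∀ b, MeasurableSet (G ⁻¹' {b}))
    {T : Finset (Fin n)} (hT : T ≠ univ) {γ : ℝ≥0∞}
    (hγ : ∀ R ⊂ range n, #R = #T → volume (G ⁻¹' {R}) = γ)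
    {E : Set (T → S)} (hE : MeasurableSet E) :
    Measure.pi (fun _ : Fin n => ρ) {x | (fun i : T => x i) ∈ E ∧
        T.image (rankAmong (v ∘ x)) = G ((∑ i, w (x i) : ℝ) : UnitAddCircle)}
      = γ * Measure.pi (fun _ : Fin n => ρ) {x | (fun i : T => x i) ∈ E} := by
  obtain ⟨i, hi⟩ : ∃ i, i ∉ T := by
    by_contra! h
    exact hT (eq_univ_of_forall h)
  set A : Set (Fin n → S) := {x | (fun i : T => x i) ∈ E} with hA
  set C : Set (Fin n → S) :=
    {x | T.image (rankAmong (v ∘ x)) = G ((∑ i, w (x i) : ℝ) : UnitAddCircle)} with hC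
  have hAm : MeasurableSet A :=
    (measurable_pi_lambda (fun (x : Fin n → S) (i : T) => x i) fun i => measurable_pi_apply _) hE
  have hCm : MeasurableSet C := measurableSet_image_rankAmong_eq hv hw hG T
  show Measure.pi (fun _ : Fin n => ρ) (A ∩ C) = γ * Measure.pi (fun _ : Fin n => ρ) A
  rw [← lintegral_indicator_one (hAm.inter hCm), ← lintegral_indicator_one hAm,
    ← lintegral_const_mul _ (measurable_one.indicator hAm)]
  refine lintegral_eq_of_lmarginal_eq {i} (measurable_one.indicator (hAm.inter hCm))
    ((measurable_one.indicator hAm).const_mul _) ?_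
  rw [lmarginal_singleton, lmarginal_singleton]
  funext x
  have hupd : ∀ y, Function.update x i y ∈ A ↔ x ∈ A := fun y => by
    have : (fun j : T => Function.update x i y j) = fun j : T => x j := by
      funext j
      exact Function.update_of_ne (fun h : (j : Fin n) = i => hi (h ▸ j.2)) _ _
    show (fun j : T => Function.update x i y j) ∈ E ↔ _
    rw [this]
    rfl
  -- Resampling the discarded point `x i` may change the ranks of `T`, but they remain a proper
  -- subset of the same size, so the selection probability is still `γ`.
  have hcond : ρ {y | Function.update x i y ∈ C} = γ := by
    have h1 : {y | Function.update x i y ∈ C} = {y |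
        T.image (rankAmong (Function.update (v ∘ x) i (v y))) =
          G ((w y + ∑ j ∈ univ \ {i}, w (x j) : ℝ) : UnitAddCircle)} := by
      ext y
      have h2 : ∑ j, w (Function.update x i y j) = w y + ∑ j ∈ univ \ {i}, w (x j) := by
        have : ∀ j, w (Function.update x i y j) = Function.update (w ∘ x) i (w y) j := fun j => by
          rw [← Function.comp_update]; rfl
        simp_rw [this]
        rw [sum_update_of_mem (mem_univ i)]
        rfl
      simp only [hC, Set.mem_ofPred_eq, h2, Function.comp_update]
    rw [h1]
    refine measure_eq_shifted_label hv hw hvw hG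
      (R := fun t => T.image (rankAmong (Function.update (v ∘ x) i t)))
      (fun R => ?_) (fun t => ?_) _
    · exact (measurable_update (v ∘ x)) (measurableSet_image_rankAmong T R)
    · exact hγ _ (image_rankAmong_ssubset _ hT)
        (card_image_of_injective _ (rankAmong_injective _))
  by_cases hx : x ∈ A
  · have h1 : ∀ y, (A ∩ C).indicator (1 : (Fin n → S) → ℝ≥0∞) (Function.update x i y)
        = {y | Function.update x i y ∈ C}.indicator 1 y := fun y => by
      simp [Set.indicator, hupd, hx]
    simp_rw [h1]
    rw [lintegral_indicator_one (s := {y | Function.update x i y ∈ C})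
      ((measurable_update x) hCm), hcond]
    simp [Set.indicator, hupd, hx]
  · simp [Set.indicator, hupd, hx]

-- A subtuple of an i.i.d. tuple is i.i.d., and the point measure forgets the indexing.
open Finset in
lemma measure_tuplePointMeasure_restrict {n : ℕ} (T : Finset (Fin n))
    {E : Set (SimplePointMeasure S)} (hE : MeasurableSet E) :
    Measure.pi (fun _ : Fin n => ρ) {x | tuplePointMeasure (fun i : T => x i) ∈ E}
      = sampleLaw ρ #T E := by
  have h := hasLaw_pi_comp_injective ρ (e := fun k : Fin #T => (T.equivFin.symm k : Fin n))
    (Subtype.val_injective.comp T.equivFin.symm.injective)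
  rw [sampleLaw, Measure.map_apply measurable_tuplePointMeasure hE, ← h.map_eq,
    Measure.map_apply (by fun_prop) (measurable_tuplePointMeasure hE)]
  congr 1
  ext x
  have := tuplePointMeasure_comp_equiv T.equivFin.symm fun i : T => x i
  simp only [Set.mem_ofPred_eq, Set.mem_preimage, ← this]
  rfl

open Finset in
/-- The thinning turns `n` independent points into a random smaller number of independent
points. -/
lemma map_rankThinning_sampleLaw (hv : Measurable v) (hw : Measurable w) (hw0 : ∀ y, 0 ≤ w y)
    (hvw : ρ.map (fun x => (v x, w x)) =
      (volume.restrict (Set.Ioc (0 : ℝ) 1)).prod (volume.restrict (Set.Ioc (0 : ℝ) 1)))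
    (hinj : ∀ n, ∀ᵐ x ∂Measure.pi (fun _ : Fin n => ρ), Function.Injective (v ∘ x))
    {G : ℕ → UnitAddCircle → Finset ℕ} (hG : ∀ n T, MeasurableSet (G n ⁻¹' {T}))
    {n : ℕ} {p : ℕ → ℝ≥0∞} (hp : ∀ j, p j ≠ 0 → j < n) (hsub : ∀ z, G n z ⊂ range n)
    (hvol : ∀ T ⊂ range n, volume (G n ⁻¹' {T}) = p #T / n.choose #T) :
    (sampleLaw ρ n).map (rankThinning hv w G) = Measure.sum fun j => p j • sampleLaw ρ j := by
  have hf := measurable_rankThinning hv hw hG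
  have hpn : p n = 0 := by
    by_contra h
    exact lt_irrefl _ (hp n h)
  ext E hE
  let D : Finset (Fin n) → Set (Fin n → S) := fun T =>
    {x | (fun i : T => x i) ∈ tuplePointMeasure ⁻¹' E ∧
      T.image (rankAmong (v ∘ x)) = G n ((∑ i, w (x i) : ℝ) : UnitAddCircle)}
  have hD : ∀ T, Measure.pi (fun _ : Fin n => ρ) (D T) =
      p #T / n.choose #T * sampleLaw ρ #T E := by
    intro T
    by_cases hT : T = univ
    · have : D T = ∅ := by
        ext x
        simp only [D, hT, image_rankAmong_univ, Set.mem_ofPred_eq,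
          Set.mem_empty_iff_false, iff_false]
        exact fun h => (hsub _).ne h.2.symm
      rw [this, hT]
      simp [hpn]
    · rw [← measure_tuplePointMeasure_restrict T hE]
      exact measure_tuple_selected hv hw hvw (hG n) hT
        (fun R hR hRT => by rw [hvol R hR, hRT]) (measurable_tuplePointMeasure hE)
  have hDm : ∀ T, MeasurableSet (D T) := fun T =>
    ((measurable_pi_lambda (fun (x : Fin n → S) (i : T) => x i) fun i => measurable_pi_apply _)
      (measurable_tuplePointMeasure hE)).inter
      (measurableSet_image_rankAmong_eq hv hw (hG n) T)
  rw [Measure.map_apply hf hE, sampleLaw,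
    Measure.map_apply measurable_tuplePointMeasure (hf hE), Measure.sum_apply _ hE]
  have hae : (tuplePointMeasure ⁻¹' (rankThinning hv w G ⁻¹' E) : Set (Fin n → S))
      =ᵐ[Measure.pi fun _ : Fin n => ρ] ⋃ T ∈ (univ : Finset (Finset (Fin n))), D T := by
    filter_upwards [hinj n] with x hx
    refine propext ?_
    show rankThinning hv w G (tuplePointMeasure x) ∈ E ↔ x ∈ ⋃ T ∈ univ, D T
    have hiff : ∀ T : Finset (Fin n),
        T.image (rankAmong (v ∘ x)) = G n ((∑ i, w (x i) : ℝ) : UnitAddCircle) ↔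
        ∀ i, i ∈ T ↔ rankAmong (v ∘ x) i ∈ G n ((∑ i, w (x i) : ℝ) : UnitAddCircle) := by
      intro T
      constructor
      · intro h i
        rw [← h, (rankAmong_injective _).mem_finset_image]
      · intro h
        ext r
        rw [mem_image]
        constructor
        · rintro ⟨i, hi, rfl⟩
          exact (h i).1 hi
        · intro hr
          have := (hsub _).subset hr
          rw [← image_rankAmong_univ (v ∘ x)] at this
          obtain ⟨i, _, rfl⟩ := mem_image.1 this
          exact ⟨i, (h i).2 hr, rfl⟩
    simp only [D, Set.mem_iUnion, mem_univ, exists_prop, true_and, Set.mem_ofPred_eq,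
      Set.mem_preimage, hiff]
    constructor
    · intro h
      refine ⟨univ.filter fun i =>
        rankAmong (v ∘ x) i ∈ G n ((∑ i, w (x i) : ℝ) : UnitAddCircle), ?_, by simp⟩
      rwa [← rankThinning_tuplePointMeasure hv hw hw0 (G := G) hx (by simp)]
    · rintro ⟨T, h, hT⟩
      rwa [rankThinning_tuplePointMeasure hv hw hw0 hx hT]
  rw [measure_congr hae, measure_biUnion_finset ?_ fun T _ => hDm T]
  -- Summing over the `n.choose j` index sets of size `j` cancels the denominator.
  · simp_rw [hD, ← powerset_univ]
    rw [sum_powerset_apply_card fun j => p j / n.choose j * sampleLaw ρ j E, card_univ,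
      Fintype.card_fin, tsum_eq_sum (s := range (n + 1))]
    · refine sum_congr rfl fun j hj => ?_
      have : n.choose j ≠ 0 := (Nat.choose_pos (by simp at hj; omega)).ne'
      rw [nsmul_eq_mul, ← mul_assoc, ENNReal.mul_div_cancel (by exact_mod_cast this) (by simp)]
      rfl
    · intro j hj
      have : p j = 0 := by
        by_contra h
        exact hj (mem_range.2 ((hp j h).trans (Nat.lt_succ_self n)))
      simp [this]
  · intro T _ T' _ hTT'
    refine Set.disjoint_left.2 fun x hx hx' => hTT' ?_
    exact image_injective (rankAmong_injective (v ∘ x)) (hx.2.trans hx'.2.symm)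

end

/-! ### From transition matrices to thinnings -/

section

variable {d : ℕ} {S : Set (EuclideanSpace ℝ (Fin d))} {ρ : Measure S}

open Finset in
/-- A deterministic thinning that realises a given transition matrix of the number of points,
provided that a number of points is either never changed or always reduced. -/
lemma exists_thinning_of_matrix [IsProbabilityMeasure ρ] {v w : S → ℝ} (hv : Measurable v)
    (hw : Measurable w) (hw0 : ∀ y, 0 ≤ w y)
    (hvw : ρ.map (fun x => (v x, w x)) =
      (volume.restrict (Set.Ioc (0 : ℝ) 1)).prod (volume.restrict (Set.Ioc (0 : ℝ) 1)))
    (hinj : ∀ n, ∀ᵐ x ∂Measure.pi (fun _ : Fin n => ρ), Function.Injective (v ∘ x))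
    {W : ℕ → ℕ → ℝ≥0∞} (hsum : ∀ n, ∑' j, W n j = 1) {k : ℕ}
    (hW : ∀ n j, W n j ≠ 0 → (n ≤ k ∧ j = n) ∨ (k < n ∧ j < n)) :
    ∃ f : SimplePointMeasure S → SimplePointMeasure S, Measurable f ∧
      (∀ ν, (f ν).points ⊆ ν.points) ∧
      ∀ n, (sampleLaw ρ n).map f = Measure.sum fun j => W n j • sampleLaw ρ j := by
  have hex : ∀ n, ∃ G : UnitAddCircle → Finset ℕ, (∀ T, MeasurableSet (G ⁻¹' {T})) ∧
      (n ≤ k → ∀ z, G z = range n) ∧ (k < n → (∀ z, G z ⊂ range n) ∧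
        ∀ T ⊂ range n, volume (G ⁻¹' {T}) = W n #T / n.choose #T) := by
    intro n
    rcases le_or_gt n k with hn | hn
    · exact ⟨fun _ => range n, fun T => MeasurableSet.const _, fun _ _ => rfl,
        fun h => absurd hn (not_le.2 h)⟩
    · obtain ⟨G, h1, h2, h3⟩ := exists_random_ssubset (hsum n) fun j hj =>
        ((hW n j hj).resolve_left fun h => absurd hn (not_lt.2 h.1)).2
      exact ⟨G, h2, fun h => absurd hn (not_lt.2 h), fun _ => ⟨h1, h3⟩⟩
  choose G hG hle hgt using hex
  have hf := measurable_rankThinning hv hw hG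
  refine ⟨rankThinning hv w G, hf, rankThinning_points_subset hv, fun n => ?_⟩
  rcases le_or_gt n k with hn | hn
  · have hWn : ∀ j, j ≠ n → W n j = 0 := fun j hj => by
      by_contra h
      rcases hW n j h with h' | h'
      · exact hj h'.2
      · omega
    have hWnn : W n n = 1 := by rw [← hsum n, tsum_eq_single n hWn]
    have hmap : (sampleLaw ρ n).map (rankThinning hv w G) = sampleLaw ρ n := by
      rw [sampleLaw, Measure.map_map hf measurable_tuplePointMeasure]
      refine Measure.map_congr ?_
      filter_upwards [hinj n] with x hx
      rw [Function.comp_apply, rankThinning_tuplePointMeasure hv hw hw0 hx (T := univ)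
        fun i => by simp [hle n hn, rankAmong_lt]]
      convert tuplePointMeasure_comp_equiv (Equiv.subtypeUnivEquiv fun i => mem_univ i) x using 1
      congr!
    rw [hmap]
    ext E hE
    rw [Measure.sum_apply _ hE, tsum_eq_single n fun j hj => by simp [hWn j hj]]
    simp [hWnn]
  · exact map_rankThinning_sampleLaw hv hw hw0 hvw hinj hG
      (fun j hj => ((hW n j hj).resolve_left fun h => absurd hn (not_lt.2 h.1)).2)
      (hgt n hn).1 (hgt n hn).2

/-- Coupled numbers of points give coupled Poisson samples. -/
lemma map_poissonSampleLaw_of_coupling {a b : ℝ≥0} {W : ℕ → ℕ → ℝ≥0∞}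
    (hcol : ∀ j, ∑' n, poissonMeasure a {n} * W n j = poissonMeasure b {j})
    {f : SimplePointMeasure S → SimplePointMeasure S} (hf : Measurable f)
    (hmap : ∀ n, (sampleLaw ρ n).map f = Measure.sum fun j => W n j • sampleLaw ρ j) :
    (poissonSampleLaw ρ a).map f = poissonSampleLaw ρ b := by
  rw [poissonSampleLaw, Measure.map_sum hf.aemeasurable]
  ext E hE
  simp_rw [Measure.map_smul, hmap]
  rw [poissonSampleLaw, Measure.sum_apply _ hE, Measure.sum_apply _ hE]
  simp only [Measure.smul_apply, smul_eq_mul, Measure.sum_apply _ hE, ← ENNReal.tsum_mul_left]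
  rw [ENNReal.tsum_comm]
  refine tsum_congr fun j => ?_
  rw [← hcol j, ← ENNReal.tsum_mul_right]
  exact tsum_congr fun n => (mul_assoc _ _ _).symm

lemma sampleLaw_apply_eq_zero [IsProbabilityMeasure ρ] [NullSingletonClass ρ] {m n : ℕ}
    (hmn : n ≠ m) {E : Set (SimplePointMeasure S)} (hEm : ∀ ν ∈ E, ν.1 Set.univ = m) :
    sampleLaw ρ n E = 0 := by
  refine measure_mono_null (t := (fun ν : SimplePointMeasure S => ν.1 Set.univ) ⁻¹' {(m : ℝ≥0∞)})
    hEm ?_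
  rw [sampleLaw, Measure.map_apply measurable_tuplePointMeasure
    (SimplePointMeasure.measurable_apply MeasurableSet.univ (measurableSet_singleton _))]
  have h := ae_injective ρ (ι := Fin n)
  rw [ae_iff] at h
  refine measure_mono_null (t := {x : Fin n → S | ¬ Function.Injective x})
    (fun x hx (hxi : Function.Injective x) => hmn ?_) h
  have hx' : (tuplePointMeasure x).1 Set.univ = m := hx
  rw [tuplePointMeasure_apply hxi MeasurableSet.univ] at hx'
  simpa using hx'

/-- The factor `sampleLaw ρ m E` does not involve `a`: conditioned on the count, all intensities
agree. -/
lemma poissonSampleLaw_apply_of_count [IsProbabilityMeasure ρ] [NullSingletonClass ρ] (a : ℝ≥0)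
    {m : ℕ} {E : Set (SimplePointMeasure S)} (hE : MeasurableSet E)
    (hEm : ∀ ν ∈ E, ν.1 Set.univ = m) :
    poissonSampleLaw ρ a E = poissonMeasure a {m} * sampleLaw ρ m E := by
  rw [poissonSampleLaw, Measure.sum_apply _ hE, tsum_eq_single m]
  · rfl
  · intro n hn
    simp [sampleLaw_apply_eq_zero hn hEm]

end

/-! ### The obstruction -/

section

variable {d : ℕ} {S : Set (EuclideanSpace ℝ (Fin d))}

lemma SimplePointMeasure.exists_eq_sum_points (ν : SimplePointMeasure S) :
    ν.1 = Measure.sum (fun a : ν.points => Measure.dirac (a : S)) := by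
  obtain ⟨A, -, hA⟩ := ν.2
  have : ν.points = A := by
    ext x
    show ν.1 {x} = 1 ↔ _
    rw [hA, Measure.sum_apply _ (measurableSet_singleton x),
      tsum_subtype A fun a => Measure.dirac a {x}, tsum_eq_single x]
    · by_cases hx : x ∈ A <;> simp [hx]
    · intro y hy
      by_cases hyA : y ∈ A <;> simp [hyA, hy]
  rw [this, ← hA]

lemma SimplePointMeasure.le_of_points_subset {ν ν' : SimplePointMeasure S}
    (h : ν.points ⊆ ν'.points) : ν.1 ≤ ν'.1 := by
  rw [ν.exists_eq_sum_points, ν'.exists_eq_sum_points, Measure.le_iff]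
  intro B hB
  rw [Measure.sum_apply _ hB, Measure.sum_apply _ hB]
  exact ENNReal.tsum_mono_subtype (fun a => Measure.dirac a B) h

lemma SimplePointMeasure.eq_of_points_subset {ν ν' : SimplePointMeasure S}
    (h : ν.points ⊆ ν'.points) (hu : ν.1 Set.univ = ν'.1 Set.univ) (hfin : ν'.1 Set.univ ≠ ⊤) :
    ν = ν' := by
  have : IsFiniteMeasure ν.1 := ⟨by rw [hu]; exact hfin.lt_top⟩
  exact Subtype.ext (Measure.eq_of_le_of_measure_univ_eq (le_of_points_subset h) hu)

lemma ae_exists_natCast_of_hasLaw_poisson {Ω : Type*} [MeasurableSpace Ω] {P : Measure Ω}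
    {X : Ω → ℝ≥0∞} {r : ℝ≥0} (hX : HasLaw X ((poissonMeasure r).map (Nat.cast : ℕ → ℝ≥0∞)) P) :
    ∀ᵐ ω ∂P, ∃ n : ℕ, X ω = n := by
  have hm : MeasurableSet {x : ℝ≥0∞ | ∃ n : ℕ, x = n} := by
    have : {x : ℝ≥0∞ | ∃ n : ℕ, x = n} = Set.range (Nat.cast : ℕ → ℝ≥0∞) := by
      ext x; simp [eq_comm]
    rw [this]
    exact (Set.countable_range _).measurableSet
  rw [hX.ae_iff (p := fun x => ∃ n : ℕ, x = n) (by exact measurableSet_setOfPred.1 hm),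
    ae_map_iff (by fun_prop) hm]
  exact Filter.Eventually.of_forall fun n => ⟨n, rfl⟩

lemma measure_le_natCast_of_hasLaw_poisson {Ω : Type*} [MeasurableSpace Ω] {P : Measure Ω}
    {X : Ω → ℝ≥0∞} {r : ℝ≥0} (hX : HasLaw X ((poissonMeasure r).map (Nat.cast : ℕ → ℝ≥0∞)) P)
    (n : ℕ) :
    P {ω | X ω ≤ n} = poissonMeasure r (Set.Iic n) := by
  rw [hX.measure_eq (p := fun x => x ≤ n) measurableSet_Iic]
  change (poissonMeasure r).map _ (Set.Iic (n : ℝ≥0∞)) = _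
  rw [Measure.map_apply (by fun_prop) measurableSet_Iic]
  congr 1
  ext m
  simp

/-- There is no deterministic thinning if exactly `k + 1` points are less likely at the lower
intensity, and at most `k` points at the lower intensity are less likely than at most `k + 1`
points at the higher one. -/
lemma not_isThinning (hS : MeasurableSet S) (h0 : 0 < volume S) (hfin : volume S < ⊤)
    [NullSingletonClass (uniformMeasure S)] {lam mu : ℝ≥0}
    {Ω : Type*} [MeasurableSpace Ω] {P : Measure Ω} [IsProbabilityMeasure P]
    {N : Ω → SimplePointMeasure S} (hN : IsPoissonProcess N lam P) {k : ℕ}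
    (h1 : poissonMeasure (mu * (volume S).toNNReal) {k + 1} <
      poissonMeasure (lam * (volume S).toNNReal) {k + 1})
    (h2 : poissonMeasure (mu * (volume S).toNNReal) (Set.Iic k) <
      poissonMeasure (lam * (volume S).toNNReal) (Set.Iic (k + 1)))
    (f : SimplePointMeasure S → SimplePointMeasure S) : ¬ IsThinning f N mu P := by
  intro hf
  have := isProbabilityMeasure_uniformMeasure hS h0 hfin
  have himg : (Subtype.val '' (Set.univ : Set S) : Set (EuclideanSpace ℝ (Fin d))) = S := by simp
  have lawN := hN.hasLaw_count Set.univ MeasurableSet.univ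
  have lawF := hf.isPoissonProcess.hasLaw_count Set.univ MeasurableSet.univ
  rw [himg] at lawN lawF
  have hcount : Measurable fun ν : SimplePointMeasure S => ν.1 Set.univ :=
    SimplePointMeasure.measurable_apply MeasurableSet.univ
  let E : Set (SimplePointMeasure S) :=
    {ν | ν.1 Set.univ = (k + 1 : ℕ)} ∩ {ν | (f ν).1 Set.univ = (k + 1 : ℕ)}
  have hE : MeasurableSet E := (hcount (measurableSet_singleton _)).inter
    ((hcount.comp hf.measurable) (measurableSet_singleton _))
  have mapN := (isPoissonProcess_iff_map_eq hS h0 hfin).1 hN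
  have mapF := (isPoissonProcess_iff_map_eq hS h0 hfin).1 hf.isPoissonProcess
  have hEN : P (N ⁻¹' E) = poissonMeasure (lam * (volume S).toNNReal) {k + 1} *
      sampleLaw (uniformMeasure S) (k + 1) E := by
    rw [← Measure.map_apply mapN.1 hE, mapN.2]
    exact poissonSampleLaw_apply_of_count _ hE fun ν hν => hν.1
  have hEF : P ((fun ω => f (N ω)) ⁻¹' E) = poissonMeasure (mu * (volume S).toNNReal) {k + 1} *
      sampleLaw (uniformMeasure S) (k + 1) E := by
    rw [← Measure.map_apply mapF.1 hE, mapF.2]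
    exact poissonSampleLaw_apply_of_count _ hE fun ν hν => hν.1
  have hle : P (N ⁻¹' E) ≤ P ((fun ω => f (N ω)) ⁻¹' E) := by
    refine measure_mono_ae ?_
    filter_upwards [hf.points_subset] with ω hω
    intro hωE
    have hωE' : N ω ∈ E := hωE
    have heq : f (N ω) = N ω := SimplePointMeasure.eq_of_points_subset hω
      (hωE'.2.trans hωE'.1.symm) (by rw [hωE'.1]; exact ENNReal.natCast_ne_top _)
    show f (N ω) ∈ E
    rwa [heq]
  -- Otherwise almost surely no configuration of `k + 1` points is kept whole, so at most `k + 1`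
  -- points always become at most `k`, against `h2`.
  have hpos : sampleLaw (uniformMeasure S) (k + 1) E ≠ 0 := by
    intro hzero
    rw [hzero, mul_zero] at hEN
    have hnull : ∀ᵐ ω ∂P, ¬ N ω ∈ E := by
      rw [ae_iff]
      simp only [not_not]
      exact hEN
    refine absurd h2 (not_lt.2 ?_)
    rw [← measure_le_natCast_of_hasLaw_poisson lawN, ← measure_le_natCast_of_hasLaw_poisson lawF]
    refine measure_mono_ae ?_
    filter_upwards [hf.points_subset, hnull, ae_exists_natCast_of_hasLaw_poisson lawN,
      ae_exists_natCast_of_hasLaw_poisson lawF] with ω hω hωE hNn hFn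
    obtain ⟨n, hn⟩ := hNn
    obtain ⟨m, hm⟩ := hFn
    intro hωk
    have hωk' : (N ω).1 Set.univ ≤ ((k + 1 : ℕ) : ℝ≥0∞) := hωk
    have hmn : (f (N ω)).1 Set.univ ≤ (N ω).1 Set.univ :=
      SimplePointMeasure.le_of_points_subset hω Set.univ
    show (f (N ω)).1 Set.univ ≤ k
    have hωE' : ¬ ((N ω).1 Set.univ = (k + 1 : ℕ) ∧ (f (N ω)).1 Set.univ = (k + 1 : ℕ)) := hωE
    rw [hn, hm] at hωE' hmn
    rw [hn] at hωk'
    rw [hm]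
    simp only [Nat.cast_inj, Nat.cast_le] at hωE' hmn hωk' ⊢
    omega
  rw [hEN, hEF] at hle
  exact absurd h1 (not_lt.2 ((ENNReal.mul_le_mul_iff_left hpos (measure_ne_top _ _)).1 hle))

end

/-! ### Sufficiency and the equivalence -/

lemma poissonMeasure_singleton_eq_ofReal (a : ℝ≥0) (n : ℕ) :
    poissonMeasure a {n} = ENNReal.ofReal (poissonMass a n) := poissonMeasure_singleton a n

lemma poissonMeasure_Iic (a : ℝ≥0) (n : ℕ) :
    poissonMeasure a (Set.Iic n) =
      ENNReal.ofReal (∑ i ∈ Finset.range (n + 1), poissonMass a i) := by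
  have : Set.Iic n = (Finset.range (n + 1) : Set ℕ) := by
    ext m; simp
  rw [this, ← sum_measure_singleton, ENNReal.ofReal_sum_of_nonneg]
  · exact Finset.sum_congr rfl fun i _ => poissonMeasure_singleton_eq_ofReal a i
  · intro i _
    unfold poissonMass
    positivity

/-- There is an index at which the masses of the two Poisson distributions cross. -/
lemma exists_poissonMass_crossing {a b : ℝ} (hb : 0 < b) (hab : b < a) :
    ∃ k, poissonMass a k ≤ poissonMass b k ∧ poissonMass b (k + 1) < poissonMass a (k + 1) := by
  classical
  have ex := exists_lt_poissonMass hb hab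
  obtain ⟨k, hk⟩ : ∃ k, Nat.find ex = k + 1 := by
    refine Nat.exists_eq_succ_of_ne_zero fun h => ?_
    have := Nat.find_spec ex
    rw [h, ← not_le, poissonMass_le_iff hb] at this
    simp at this
    linarith
  exact ⟨k, not_lt.1 (Nat.find_min ex (hk ▸ Nat.lt_succ_self k)), hk ▸ Nat.find_spec ex⟩

section

variable {d : ℕ} {S : Set (EuclideanSpace ℝ (Fin d))}

lemma measure_preimage_singleton_eq_zero {ρ : Measure S} {v w : S → ℝ} (hv : Measurable v)
    (hw : Measurable w) (hvw : ρ.map (fun x => (v x, w x)) =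
      (volume.restrict (Set.Ioc (0 : ℝ) 1)).prod (volume.restrict (Set.Ioc (0 : ℝ) 1))) (t : ℝ) :
    ρ (v ⁻¹' {t}) = 0 := by
  have h := Measure.map_apply (μ := ρ) (hv.prodMk hw)
    (measurable_fst (measurableSet_singleton t) : MeasurableSet (Prod.fst ⁻¹' {t} : Set (ℝ × ℝ)))
  rw [hvw, ← Set.prod_univ, Measure.prod_prod, measure_singleton, zero_mul] at h
  refine Eq.trans ?_ h.symm
  congr 1
  ext x
  simp

lemma nullSingletonClass_uniformMeasure (hd : 1 ≤ d) (hS : MeasurableSet S) (h0 : 0 < volume S)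
    (hfin : volume S < ⊤) : NullSingletonClass (uniformMeasure S) := by
  have := isProbabilityMeasure_uniformMeasure hS h0 hfin
  obtain ⟨v, w, hv, hw, -, hvw⟩ := exists_uniform_labels hd hS (uniformMeasure S)
    uniformMeasure_absolutelyContinuous
  refine ⟨fun x => measure_mono_null ?_ (measure_preimage_singleton_eq_zero hv hw hvw (v x))⟩
  simp

/-- The sufficient condition for the existence of a deterministic thinning. -/
lemma exists_isThinning (hd : 1 ≤ d) (hS : MeasurableSet S) (h0 : 0 < volume S)
    (hfin : volume S < ⊤) [NullSingletonClass (uniformMeasure S)] {lam mu : ℝ≥0} (hmu : 0 < mu)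
    (hlam : mu < lam) {Ω : Type*} [MeasurableSpace Ω] {P : Measure Ω} [IsProbabilityMeasure P]
    {N : Ω → SimplePointMeasure S} (hN : IsPoissonProcess N lam P) {k : ℕ}
    (h1 : poissonMeasure (lam * (volume S).toNNReal) {k} ≤
      poissonMeasure (mu * (volume S).toNNReal) {k})
    (h2 : poissonMeasure (lam * (volume S).toNNReal) (Set.Iic (k + 1)) ≤
      poissonMeasure (mu * (volume S).toNNReal) (Set.Iic k)) :
    ∃ f : SimplePointMeasure S → SimplePointMeasure S, IsThinning f N mu P := by
  have := isProbabilityMeasure_uniformMeasure hS h0 hfin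
  have hvol : 0 < (volume S).toNNReal := ENNReal.toNNReal_pos h0.ne' hfin.ne
  set a := lam * (volume S).toNNReal with ha
  set b := mu * (volume S).toNNReal with hb
  have hb0 : 0 < b := mul_pos hmu hvol
  have hab : b < a := mul_lt_mul_of_pos_right hlam hvol
  have hb' : (0 : ℝ) < b := NNReal.coe_pos.2 hb0
  have hab' : (b : ℝ) < a := NNReal.coe_lt_coe.2 hab
  have pa : ∀ n, 0 < poissonMass (a : ℝ) n := poissonMass_pos (hb'.trans hab')
  have pb : ∀ n, 0 < poissonMass (b : ℝ) n := poissonMass_pos hb'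
  rw [poissonMeasure_singleton_eq_ofReal, poissonMeasure_singleton_eq_ofReal,
    ENNReal.ofReal_le_ofReal_iff (pb k).le] at h1
  rw [poissonMeasure_Iic, poissonMeasure_Iic, ENNReal.ofReal_le_ofReal_iff
    (Finset.sum_nonneg fun i _ => (pb i).le)] at h2
  obtain ⟨J, hrow, hcol, hJ⟩ := exists_coupling (fun n => (pa n).le)
    (fun n => (pb n).le) (hasSum_poissonMass a) (hasSum_poissonMass b) k
    (fun j hj => poissonMass_le_of_le hb' hab' hj h1)
    fun m hm => sum_poissonMass_succ_le hb0 hab h2 hm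
  simp_rw [← poissonMeasure_singleton_eq_ofReal] at hrow hcol
  have hpos : ∀ n, poissonMeasure a {n} ≠ 0 := fun n => by
    rw [poissonMeasure_singleton_eq_ofReal]
    simpa using pa n
  obtain ⟨v, w, hv, hw, hw0, hvw⟩ := exists_uniform_labels hd hS (uniformMeasure S)
    uniformMeasure_absolutelyContinuous
  have hvnull := measure_preimage_singleton_eq_zero hv hw hvw
  -- Rows of the coupling are normalised to conditional laws of the output count given the input
  -- count.
  obtain ⟨f, hf, hpts, hmap⟩ := exists_thinning_of_matrix hv hw hw0 hvw
    (fun n => ae_injective_comp _ hv hvnull) (W := fun n j => J n j / poissonMeasure a {n}) (k := k)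
    (fun n => by
      simp_rw [div_eq_mul_inv]
      rw [ENNReal.tsum_mul_right, hrow, ENNReal.mul_inv_cancel (hpos n) (measure_ne_top _ _)])
    (fun n j h => hJ n j fun h0 => h (by simp [h0]))
  refine ⟨f, hf, ?_, Filter.Eventually.of_forall fun ω => hpts _⟩
  have mapN := (isPoissonProcess_iff_map_eq hS h0 hfin).1 hN
  refine (isPoissonProcess_iff_map_eq hS h0 hfin).2 ⟨hf.comp mapN.1, ?_⟩
  have h3 := Measure.map_map (μ := P) hf mapN.1
  rw [mapN.2, map_poissonSampleLaw_of_coupling (a := a) (b := b) (fun j => ?_) hf hmap] at h3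
  · exact h3.symm
  · rw [← hcol j]
    exact tsum_congr fun n => ENNReal.mul_div_cancel (hpos n) (measure_ne_top _ _)

end

theorem theorem1 {d : ℕ} (hd : 1 ≤ d) (lam mu : ℝ≥0) (hmu : 0 < mu) (hlam : mu < lam)
    (S : Set (EuclideanSpace ℝ (Fin d))) (hS : MeasurableSet S)
    (hS_pos : 0 < volume S) (hS_fin : volume S < ⊤)
    {Ω : Type*} [MeasurableSpace Ω] (P : Measure Ω) [IsProbabilityMeasure P]
    (N : Ω → SimplePointMeasure S) (hN : IsPoissonProcess N lam P)
    {Ω₁ : Type*} [MeasurableSpace Ω₁] (P₁ : Measure Ω₁) [IsProbabilityMeasure P₁]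
    (X : Ω₁ → ℕ) (hX : HasLaw X (poissonMeasure (lam * (volume S).toNNReal)) P₁)
    {Ω₂ : Type*} [MeasurableSpace Ω₂] (P₂ : Measure Ω₂) [IsProbabilityMeasure P₂]
    (Y : Ω₂ → ℕ) (hY : HasLaw Y (poissonMeasure (mu * (volume S).toNNReal)) P₂) :
    List.TFAE [
      ∃ f : SimplePointMeasure S → SimplePointMeasure S, IsThinning f N mu P,
      ∃ k : ℕ, P₁ {ω | X ω = k} ≤ P₂ {ω | Y ω = k} ∧
        P₁ {ω | X ω ≤ k + 1} ≤ P₂ {ω | Y ω ≤ k},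
      ¬ ∃ k : ℕ, P₁ {ω | X ω = k + 1} > P₂ {ω | Y ω = k + 1} ∧
        P₁ {ω | X ω ≤ k + 1} > P₂ {ω | Y ω ≤ k}] := by
  have := isProbabilityMeasure_uniformMeasure hS hS_pos hS_fin
  have hnull := nullSingletonClass_uniformMeasure hd hS hS_pos hS_fin
  have hXe : ∀ k, P₁ {ω | X ω = k} = poissonMeasure (lam * (volume S).toNNReal) {k} := fun k =>
    hX.measure_eq (p := fun x => x = k) (measurableSet_singleton k)
  have hYe : ∀ k, P₂ {ω | Y ω = k} = poissonMeasure (mu * (volume S).toNNReal) {k} := fun k =>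
    hY.measure_eq (p := fun x => x = k) (measurableSet_singleton k)
  have hXl : ∀ k, P₁ {ω | X ω ≤ k} = poissonMeasure (lam * (volume S).toNNReal) (Set.Iic k) :=
    fun k => hX.measure_eq (p := fun x => x ≤ k) measurableSet_Iic
  have hYl : ∀ k, P₂ {ω | Y ω ≤ k} = poissonMeasure (mu * (volume S).toNNReal) (Set.Iic k) :=
    fun k => hY.measure_eq (p := fun x => x ≤ k) measurableSet_Iic
  simp only [hXe, hYe, hXl, hYl]
  tfae_have 1 → 3 := by
    rintro ⟨f, hf⟩ ⟨k, h1, h2⟩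
    exact not_isThinning hS hS_pos hS_fin hN h1 h2 f hf
  tfae_have 3 → 2 := by
    intro h
    have hvol : 0 < (volume S).toNNReal := ENNReal.toNNReal_pos hS_pos.ne' hS_fin.ne
    have hb : 0 < mu * (volume S).toNNReal := mul_pos hmu hvol
    have hab : mu * (volume S).toNNReal < lam * (volume S).toNNReal :=
      mul_lt_mul_of_pos_right hlam hvol
    -- At the crossing both mass inequalities hold, the one at `k` for (ii) and the one at `k + 1`
    -- for (iii); excluding this `k` in (iii) leaves exactly the missing inequality of (ii).
    obtain ⟨k, hk, hk'⟩ := exists_poissonMass_crossing (NNReal.coe_pos.2 hb)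
      (NNReal.coe_lt_coe.2 hab)
    refine ⟨k, ?_, ?_⟩
    · rw [poissonMeasure_singleton_eq_ofReal, poissonMeasure_singleton_eq_ofReal]
      exact ENNReal.ofReal_le_ofReal hk
    · by_contra hlt
      refine h ⟨k, ?_, not_le.1 hlt⟩
      rw [poissonMeasure_singleton_eq_ofReal, poissonMeasure_singleton_eq_ofReal]
      exact (ENNReal.ofReal_lt_ofReal_iff (poissonMass_pos
        (NNReal.coe_pos.2 (hb.trans hab)) _)).2 hk'
  tfae_have 2 → 1 := by
    rintro ⟨k, h1, h2⟩
    exact exists_isThinning hd hS hS_pos hS_fin hmu hlam hN h1 h2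
  tfae_finish
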